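/- Let $S$ be a finite set of points in the Euclidean plane. A simple polygon with vertex set $S$ is the closed region bounded by a closed polygonal chain that visits every point of $S$ exactly once as a vertex, has at least three vertices, and whose edges meet only at common endpoints of consecutive edges (straight angles at vertices are allowed). A point $g$ of a polygon $P$ sees $a\in P$ if the segment $ga$ is contained in $P$. The interior points of $S$ are the points of $S$ that are not vertices of the convex hull $CH(S)$. An interior universal guard set for $S$ is a set $G$ of interior points of $S$ such that, for every simple polygon $P$ with vertex set $S$, every point of $P$ is seen, within $P$, from some point of $G$. For $n\in\mathbb N$, let the interior universal guard number $u_i(n)$ be the maximum, over all $n$-point sets $S$ in the plane that have an interior universal guard set, of the minimum cardinality of an interior universal guard set for $S$. Theorem. The maximum $u_i(n)$ is attained for every $n$, and $$u_i(n)=n-\Theta(1)\qquad(n\to\infty),$$ that is, there are constants $0<c\le C$ with $n-C\le u_i(n)\le n-c$ for all sufficiently large $n$. Moreover, for arbitrarily large $n$ there exist sets $S$ of $n$ points in the plane such that $CH(S)$ is a (nondegenerate) triangle and the only interior universal guard set for $S$ is the set of all $n-3$ interior points of $S$. -/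

import Mathlib

open scoped Asymptotics

namespace UniversalGuard

/-- The Euclidean plane. -/
abbrev Plane : Type := EuclideanSpace ℝ (Fin 2)

/-- A closed polygonal chain is simple if it has at least three vertices, its vertices are pairwise
distinct, and two different edges meet at most in a common endpoint. (Straight angles at vertices
are allowed.) -/
def IsSimple {m : ℕ} (v : Polygon Plane m) : Prop :=
  3 ≤ m ∧ Function.Injective v.vertices ∧
    ∀ i j : Fin m, i ≠ j →
      v.edgeSet ℝ i ∩ v.edgeSet ℝ j ⊆
        ({v i, v (finRotate m i)} ∩ {v j, v (finRotate m j)} : Set Plane)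

/-- The closed region bounded by a closed polygonal chain: the chain together with all points that
lie in a bounded connected component of its complement. -/
def region {m : ℕ} (v : Polygon Plane m) : Set Plane :=
  v.boundary ℝ ∪
    {x | x ∉ v.boundary ℝ ∧ Bornology.IsBounded (connectedComponentIn (v.boundary ℝ)ᶜ x)}

/-- The set of all simple polygons (as closed regions) whose vertex set is `S`. -/
def simplePolygons (S : Finset Plane) : Set (Set Plane) :=
  {P | ∃ (m : ℕ) (v : Polygon Plane m),
    IsSimple v ∧ Set.range v.vertices = (S : Set Plane) ∧ P = region v}

/-- The part of `P` that is visible from `g`: the points `a` of `P` such that the segment from `g`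
to `a` is contained in `P`. -/
def visibleRegion (P : Set Plane) (g : Plane) : Set Plane :=
  {a | a ∈ P ∧ segment ℝ g a ⊆ P}

/-- `G` is a guard set for `P` if every point of `P` is visible from some point of `G`. -/
def IsGuardSet (P : Set Plane) (G : Finset Plane) : Prop :=
  ⋃ g ∈ G, visibleRegion P g = P

/-- The points of `S` that are not vertices of the convex hull of `S`. -/
def interiorPoints (S : Finset Plane) : Set Plane :=
  (S : Set Plane) \ Set.extremePoints ℝ (convexHull ℝ (S : Set Plane))

/-- `G` is an interior universal guard set for `S`: it consists of points of `S` that are not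
vertices of the convex hull, and it guards every simple polygon with vertex set `S`. -/
def IsInteriorUniversalGuardSet (S G : Finset Plane) : Prop :=
  (G : Set Plane) ⊆ interiorPoints S ∧ ∀ P ∈ simplePolygons S, IsGuardSet P G

/-- `m` is the minimum cardinality of an interior universal guard set for `S`. -/
def IsMinInteriorGuardCount (S : Finset Plane) (m : ℕ) : Prop :=
  IsLeast {k : ℕ | ∃ G : Finset Plane, IsInteriorUniversalGuardSet S G ∧ G.card = k} m

/-- The minimum cardinalities of interior universal guard sets, over all sets of `n` points in the
plane that have such a guard set. -/
def minInteriorGuardCounts (n : ℕ) : Set ℕ :=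
  {m | ∃ S : Finset Plane, S.card = n ∧ IsMinInteriorGuardCount S m}

/-- The interior universal guard number: the maximum of `minInteriorGuardCounts n`. -/
noncomputable def interiorUniversalGuardNumber (n : ℕ) : ℕ :=
  sSup (minInteriorGuardCounts n)

end UniversalGuard

namespace UniversalGuard

open Set Filter Topology Bornology

/-! The upper bound and the attainment are soft. A hull vertex is never an interior point, so a
guard set has fewer than n points when n > 0; the possible counts are thus bounded, and they exist
for every n because collinear points span no simple polygon. The content is a family of point sets
with triangular hull ABC that need all, or almost all, of their interior points.

Sufficiency (`isInteriorUniversalGuardSet_of_eq`): if the hull is a triangle and some interior point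
exists, the interior points guard every polygon. From a point a inside, look towards an interior
vertex and stop at the first boundary point x. If x is a vertex, it is not a corner of the hull.
Otherwise x is in the relative interior of an edge pq, and rotating the line of sight towards p and
towards q meets visible vertices in the triangles axp and axq (`exists_visible_vertex`). If both
were corners, they would be p and q; then pq is a side of the hull, and x lying on it forces a onto
it, which is absurd. Boundary points follow by closure (`IsSimple.region_subset_closure_inside`). No
Jordan curve theorem is needed: the winding number jumps across an edge, and where it is nonzero the
component is bounded.

Necessity: `sig` is the height at which the line from B through a point meets the side AC, and `tau`
measures how far the point is towards B. The points 2k and 2k+1 form a pair with the same `tau`,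
namely 4^k, and `sig` = ±1/(k+2); a few further points have `sig` = 0. Around C the points are
sorted by index; around A they are too, except that each pair is swapped. For even q take the
polygon C, 0, …, q-1, q+1, A, B, q, q+2, …. Only q sees B (`pt_mem_of_even`): points of smaller
`sig` lie below the line Bq, off the angle at B, and the remaining ones, even i < q, lie behind the
outer pocket between the edge from q+1 to A and the path before it. Reflection swaps A with C and
the two members of each pair, which settles odd indices. With exactly one further point, the polygon
C, 0, …, 2m, A, B forces that point too, since it alone sees A (`pt_last_mem`). -/

/-! ### Topology of the boundary and of the region. -/

lemma edgeSet_eq_segment {m : ℕ} (v : Polygon Plane m) (i : Fin m) :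
    v.edgeSet ℝ i = segment ℝ (v i) (v (finRotate m i)) :=
  affineSegment_eq_segment ℝ _ _

lemma isCompact_segment (p q : Plane) : IsCompact (segment ℝ p q) := by
  rw [segment_eq_image_lineMap]
  exact isCompact_Icc.image AffineMap.lineMap_continuous

lemma isCompact_boundary {m : ℕ} (v : Polygon Plane m) : IsCompact (v.boundary ℝ) :=
  isCompact_iUnion fun i => by
    rw [edgeSet_eq_segment]
    exact isCompact_segment _ _

lemma segment_subset_boundary {m : ℕ} (v : Polygon Plane m) (i : Fin m) :
    segment ℝ (v i) (v (finRotate m i)) ⊆ v.boundary ℝ := by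
  rw [← edgeSet_eq_segment]
  exact subset_iUnion (fun i => v.edgeSet ℝ i) i

lemma mem_boundary_iff {m : ℕ} (v : Polygon Plane m) (x : Plane) :
    x ∈ v.boundary ℝ ↔ ∃ i, x ∈ segment ℝ (v i) (v (finRotate m i)) := by
  simp [Polygon.boundary, edgeSet_eq_segment]

lemma boundary_subset_region {m : ℕ} (v : Polygon Plane m) : v.boundary ℝ ⊆ region v :=
  subset_union_left

lemma isOpen_component {m : ℕ} (v : Polygon Plane m) (x : Plane) :
    IsOpen (connectedComponentIn (v.boundary ℝ)ᶜ x) :=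
  (isCompact_boundary v).isClosed.isOpen_compl.connectedComponentIn

/-- Components of the open complement are open, so the points in unbounded components form an open
set. -/
lemma isClosed_region {m : ℕ} (v : Polygon Plane m) : IsClosed (region v) := by
  rw [← isOpen_compl_iff, isOpen_iff_mem_nhds]
  intro x hx
  have hx1 : x ∉ v.boundary ℝ := fun h => hx (Or.inl h)
  have hx2 : ¬ IsBounded (connectedComponentIn (v.boundary ℝ)ᶜ x) := fun h => hx (Or.inr ⟨hx1, h⟩)
  filter_upwards [(isOpen_component v x).mem_nhds (mem_connectedComponentIn hx1)] with y hy
  rintro (h | ⟨-, h⟩)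
  · exact connectedComponentIn_subset _ _ hy h
  · rw [← connectedComponentIn_eq hy] at h
    exact hx2 h

lemma component_subset_region {m : ℕ} {v : Polygon Plane m} {x : Plane}
    (hb : IsBounded (connectedComponentIn (v.boundary ℝ)ᶜ x)) :
    connectedComponentIn (v.boundary ℝ)ᶜ x ⊆ region v := by
  intro y hy
  refine Or.inr ⟨connectedComponentIn_subset _ _ hy, ?_⟩
  rwa [← connectedComponentIn_eq hy]

lemma closure_subset_region {m : ℕ} {v : Polygon Plane m} {x : Plane} {T : Set Plane}
    (hb : IsBounded (connectedComponentIn (v.boundary ℝ)ᶜ x))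
    (hT : T ⊆ connectedComponentIn (v.boundary ℝ)ᶜ x) : closure T ⊆ region v :=
  closure_minimal (hT.trans (component_subset_region hb)) (isClosed_region v)

/-- The only way in which points are shown to be outside: a connected unbounded set avoiding the
chain lies in a single, hence unbounded, component. -/
lemma notMem_region_of_not_isBounded {m : ℕ} {v : Polygon Plane m} {x : Plane} {T : Set Plane}
    (hT : IsPreconnected T) (hd : Disjoint T (v.boundary ℝ)) (hx : x ∈ T) (hu : ¬ IsBounded T) :
    x ∉ region v := by
  rintro (h | ⟨-, h⟩)
  · exact disjoint_left.1 hd hx h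
  · exact hu (h.subset (hT.subset_connectedComponentIn hx hd.subset_compl_right))

lemma not_isBounded_of_ray {T : Set Plane} {x d : Plane} (hd : d ≠ 0)
    (h : ∀ t : ℝ, 0 ≤ t → x + t • d ∈ T) : ¬ IsBounded T := by
  intro hb
  obtain ⟨R, hR⟩ := hb.exists_norm_le
  have hd' : 0 < ‖d‖ := norm_pos_iff.2 hd
  have hR0 : 0 ≤ R := (norm_nonneg _).trans (hR _ (h 0 le_rfl))
  have ht : 0 ≤ (R + ‖x‖ + 1) / ‖d‖ := by positivity
  have h1 := hR _ (h _ ht)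
  have h2 : ‖((R + ‖x‖ + 1) / ‖d‖) • d‖ = R + ‖x‖ + 1 := by
    rw [norm_smul, Real.norm_of_nonneg ht]
    field_simp
  have h3 := norm_sub_le (x + ((R + ‖x‖ + 1) / ‖d‖) • d) x
  rw [add_sub_cancel_left, h2] at h3
  linarith

/-! ### The winding number of a polygon -/

/-- The identification of the plane with `ℂ`. -/
noncomputable def toC : Plane ≃ₗᵢ[ℝ] ℂ := Complex.orthonormalBasisOneI.repr.symm

lemma toC_mem_segment {p q x : Plane} :
    toC x ∈ segment ℝ (toC p) (toC q) ↔ x ∈ segment ℝ p q := by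
  have := image_segment ℝ (toC.toLinearEquiv : Plane →ₗ[ℝ] ℂ).toAffineMap p q
  constructor
  · intro h
    have h' : toC x ∈ ((toC.toLinearEquiv : Plane →ₗ[ℝ] ℂ).toAffineMap) '' segment ℝ p q := by
      rw [this]; exact h
    obtain ⟨y, hy, hyx⟩ := h'
    have : y = x := toC.injective hyx
    rwa [← this]
  · intro h
    have h' := mem_image_of_mem ((toC.toLinearEquiv : Plane →ₗ[ℝ] ℂ).toAffineMap) h
    rw [this] at h'
    exact h'

/-- The angle under which a directed segment is seen. -/
noncomputable def angleFrom (p q x : Plane) : ℝ :=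
  Complex.arg ((toC q - toC x) / (toC p - toC x))

/-- `2π` times the winding number of a closed polygonal chain. -/
noncomputable def winding {m : ℕ} (v : Polygon Plane m) (x : Plane) : ℝ :=
  ∑ i, angleFrom (v i) (v (finRotate m i)) x

/-- The ratio is a nonpositive real only if p and q lie on opposite sides of x or coincide with it;
the branch cut of `arg` is therefore met only on the segment. -/
lemma div_mem_slitPlane {p q x : ℂ} (h : x ∉ segment ℝ p q) :
    (q - x) / (p - x) ∈ Complex.slitPlane := by
  rw [Complex.mem_slitPlane_iff_not_le_zero]
  intro hle
  apply h
  rw [mem_segment_iff_sameRay]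
  obtain ⟨hre, him⟩ := Complex.le_def.1 hle
  rcases eq_or_ne p x with rfl | hpx
  · simp
  have hpx' : p - x ≠ 0 := sub_ne_zero.2 hpx
  set w := (q - x) / (p - x) with hw
  have hwr : w = (w.re : ℂ) := Complex.ext (by simp) (by simpa using him)
  have : q - x = (-w.re) • (x - p) := by
    rw [Complex.real_smul]
    push_cast
    rw [← hwr, hw]
    field_simp
    ring
  rw [this]
  exact SameRay.sameRay_nonneg_smul_right _ (by simpa using hre)

lemma continuousAt_angleFrom {p q x : Plane} (h : x ∉ segment ℝ p q) :
    ContinuousAt (angleFrom p q) x := by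
  have hx : toC x ∉ segment ℝ (toC p) (toC q) := fun h' => h (toC_mem_segment.1 h')
  have hne : toC p - toC x ≠ 0 := by
    intro h0
    apply hx
    rw [← sub_eq_zero.1 h0]
    exact left_mem_segment _ _ _
  have hc : ContinuousAt toC x := toC.continuous.continuousAt
  have hq : ContinuousAt (fun y => (toC q - toC y) / (toC p - toC y)) x :=
    (continuousAt_const.sub hc).div (continuousAt_const.sub hc) hne
  exact ContinuousAt.comp (f := fun y => (toC q - toC y) / (toC p - toC y))
    (Complex.continuousAt_arg (div_mem_slitPlane hx)) hq

lemma continuousAt_winding {m : ℕ} {v : Polygon Plane m} {x : Plane} (h : x ∉ v.boundary ℝ) :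
    ContinuousAt (winding v) x := by
  unfold winding
  refine tendsto_finsetSum _ fun i _ => continuousAt_angleFrom fun h' => h ?_
  exact segment_subset_boundary v i h'

/-- The ratios of consecutive vertices, seen from x, multiply to 1 around the closed chain, so the
sum of their arguments is a multiple of 2π. -/
lemma winding_mem {m : ℕ} {v : Polygon Plane m} {x : Plane} (h : x ∉ v.boundary ℝ) :
    ∃ n : ℤ, winding v x = n * (2 * Real.pi) := by
  have hne : ∀ i, toC (v i) - toC x ≠ 0 := by
    intro i h0
    apply h
    rw [← toC.injective (sub_eq_zero.1 h0)]
    exact segment_subset_boundary v i (left_mem_segment _ _ _)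
  set w : Fin m → ℂ := fun i => (toC (v (finRotate m i)) - toC x) / (toC (v i) - toC x) with hw
  have hprod : ∏ i, w i = 1 := by
    simp only [hw]
    rw [Finset.prod_div_distrib, Equiv.prod_comp (finRotate m) (fun i => toC (v i) - toC x)]
    exact div_self (Finset.prod_ne_zero_iff.2 fun i _ => hne i)
  have hnorm : ∏ i, ‖w i‖ = 1 := by rw [← norm_prod, hprod, norm_one]
  have hexp : Complex.exp (winding v x * Complex.I) = 1 := by
    have : ∏ i, ((‖w i‖ : ℂ) * Complex.exp (Complex.arg (w i) * Complex.I)) = 1 := by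
      rw [← hprod]
      exact Finset.prod_congr rfl fun i _ => Complex.norm_mul_exp_arg_mul_I _
    rw [Finset.prod_mul_distrib, ← Complex.exp_sum, ← Complex.ofReal_prod, hnorm] at this
    simp only [Complex.ofReal_one, one_mul] at this
    rw [← this, winding, Complex.ofReal_sum, Finset.sum_mul]
    rfl
  obtain ⟨n, hn⟩ := Complex.exp_eq_one_iff.1 hexp
  refine ⟨n, ?_⟩
  have h2 : (winding v x : ℂ) * Complex.I = ((n * (2 * Real.pi) : ℝ) : ℂ) * Complex.I := by
    rw [hn]; push_cast; ring
  exact_mod_cast mul_right_cancel₀ Complex.I_ne_zero h2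

lemma tendsto_angleFrom_cobounded (p q : Plane) :
    Tendsto (angleFrom p q) (cobounded Plane) (𝓝 0) := by
  have h1 : Tendsto (fun x : Plane => toC p - toC x) (cobounded Plane) (cobounded ℂ) := by
    have h := (toC.isometry.antilipschitz.tendsto_cobounded)
    rw [← tendsto_norm_atTop_iff_cobounded] at h ⊢
    refine tendsto_atTop_mono (fun x => ?_) (tendsto_atTop_add_const_right _ (-‖toC p‖) h)
    have := norm_sub_norm_le (toC x) (toC p)
    rw [norm_sub_rev] at this
    linarith
  have h2 : Tendsto (fun x : Plane => 1 + (toC q - toC p) * (toC p - toC x)⁻¹) (cobounded Plane)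
      (𝓝 1) := by
    have := ((tendsto_inv₀_cobounded.comp h1).const_mul (toC q - toC p)).const_add 1
    simpa using this
  have h3 : Tendsto (fun x : Plane => (toC q - toC x) / (toC p - toC x)) (cobounded Plane)
      (𝓝 1) := by
    refine h2.congr' ?_
    filter_upwards [h1.eventually_ne_cobounded 0] with x hx
    field_simp
    ring
  have h4 := (Complex.continuousAt_arg Complex.one_mem_slitPlane).tendsto.comp h3
  rw [Complex.arg_one] at h4
  exact h4

lemma tendsto_winding_cobounded {m : ℕ} (v : Polygon Plane m) :
    Tendsto (winding v) (cobounded Plane) (𝓝 0) := by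
  have : Tendsto (winding v) (cobounded Plane) (𝓝 (∑ _i : Fin m, 0)) :=
    tendsto_finsetSum _ fun i _ => tendsto_angleFrom_cobounded _ _
  simpa using this

/-- The winding function is continuous off the chain, takes values in 2πℤ and tends to 0 at
infinity. On an unbounded component it would have to pass through ±π between infinity and x. -/
lemma isBounded_component_of_winding_ne_zero {m : ℕ} {v : Polygon Plane m} {x : Plane}
    (hx : x ∉ v.boundary ℝ) (hw : winding v x ≠ 0) :
    IsBounded (connectedComponentIn (v.boundary ℝ)ᶜ x) := by
  by_contra hb
  have hpi := Real.pi_pos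
  have hev : ∀ᶠ y in cobounded Plane, |winding v y| < Real.pi := by
    have := (tendsto_winding_cobounded v).abs
    rw [abs_zero] at this
    exact this.eventually (gt_mem_nhds hpi)
  obtain ⟨y, hyT, hy⟩ : ∃ y ∈ connectedComponentIn (v.boundary ℝ)ᶜ x, |winding v y| < Real.pi := by
    by_contra! hcon
    apply hb
    rw [isBounded_def]
    filter_upwards [hev] with y hy hyT
    exact absurd hy (not_lt.2 (hcon y hyT))
  have hint : ∀ z ∈ connectedComponentIn (v.boundary ℝ)ᶜ x, |winding v z| ≠ Real.pi := by
    intro z hz h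
    obtain ⟨n, hn⟩ := winding_mem (connectedComponentIn_subset _ _ hz)
    rw [hn, abs_mul, abs_of_pos (by positivity : 0 < 2 * Real.pi)] at h
    have h2 : |(n : ℝ)| * 2 = 1 := by
      have : (|(n : ℝ)| * 2) * Real.pi = 1 * Real.pi := by linarith
      exact mul_right_cancel₀ hpi.ne' this
    have h3 : |n| * 2 = 1 := by exact_mod_cast h2
    omega
  have hxT := mem_connectedComponentIn (F := (v.boundary ℝ)ᶜ) hx
  have hcont : ContinuousOn (fun z => |winding v z|) (connectedComponentIn (v.boundary ℝ)ᶜ x) :=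
    fun z hz => (continuousAt_winding (connectedComponentIn_subset _ _ hz)).abs.continuousWithinAt
  have hxpi : Real.pi ≤ |winding v x| := by
    obtain ⟨n, hn⟩ := winding_mem hx
    have hn0 : n ≠ 0 := by rintro rfl; simp at hn; exact hw hn
    rw [hn, abs_mul, abs_of_pos (by positivity : 0 < 2 * Real.pi)]
    have : (1 : ℝ) ≤ |(n : ℝ)| := by exact_mod_cast Int.one_le_abs hn0
    nlinarith
  obtain ⟨z, hz, hzpi⟩ := isPreconnected_connectedComponentIn.intermediate_value hyT hxT hcont
    ⟨hy.le, hxpi⟩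
  exact hint z hz hzpi

/-- The jump of `arg` across the negative real axis: the quotient crosses it at t = 0, where it
equals -α/β. -/
lemma tendsto_arg_div {α β : ℝ} (hα : 0 < α) (hβ : 0 < β) :
    Tendsto (fun t : ℝ => Complex.arg ((α - t * Complex.I) / (-β - t * Complex.I))) (𝓝[>] 0)
        (𝓝 Real.pi) ∧
      Tendsto (fun t : ℝ => Complex.arg ((α - t * Complex.I) / (-β - t * Complex.I))) (𝓝[<] 0)
        (𝓝 (-Real.pi)) := by
  set f : ℝ → ℂ := fun t => (α - t * Complex.I) / (-β - t * Complex.I) with hf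
  have hden : ∀ t : ℝ, (-β - t * Complex.I : ℂ) ≠ 0 := by
    intro t h
    have := congrArg Complex.re h
    simp at this
    exact hβ.ne' this
  have hcont : Continuous f := by
    refine Continuous.div ?_ ?_ hden <;> fun_prop
  have him : ∀ t, (f t).im = t * ((α + β) / (β ^ 2 + t ^ 2)) := by
    intro t
    simp only [hf, Complex.div_im, Complex.normSq_apply]
    simp
    have : β * β + t * t ≠ 0 := by nlinarith [sq_nonneg t, mul_pos hβ hβ]
    have : β ^ 2 + t ^ 2 ≠ 0 := by positivity
    field_simp
    ring
  have h0 : f 0 = ((-(α / β) : ℝ) : ℂ) := by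
    simp [hf]
    rw [div_neg]
  have hre : (f 0).re < 0 := by
    rw [h0, Complex.ofReal_re]
    have := div_pos hα hβ
    linarith
  have him0 : (f 0).im = 0 := by rw [h0, Complex.ofReal_im]
  have hpos : ∀ t, 0 < (α + β) / (β ^ 2 + t ^ 2) := fun t => by positivity
  constructor
  · have h1 := (Complex.continuousWithinAt_arg_of_re_neg_of_im_zero hre him0).tendsto
    have h2 : Tendsto f (𝓝[>] 0) (𝓝[{z : ℂ | 0 ≤ z.im}] (f 0)) := by
      refine tendsto_nhdsWithin_iff.2 ⟨hcont.continuousAt.tendsto.mono_left nhdsWithin_le_nhds, ?_⟩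
      filter_upwards [self_mem_nhdsWithin] with t ht
      change _ ∈ Set.ofPred _
      rw [mem_ofPred_eq, him]
      exact (mul_pos ht (hpos t)).le
    have h3 := h1.comp h2
    rwa [h0, Complex.arg_ofReal_of_neg (by rwa [h0, Complex.ofReal_re] at hre)] at h3
  · have h1 := Complex.tendsto_arg_nhdsWithin_im_neg_of_re_neg_of_im_zero hre him0
    have h2 : Tendsto f (𝓝[<] 0) (𝓝[{z : ℂ | z.im < 0}] (f 0)) := by
      refine tendsto_nhdsWithin_iff.2 ⟨hcont.continuousAt.tendsto.mono_left nhdsWithin_le_nhds, ?_⟩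
      filter_upwards [self_mem_nhdsWithin] with t ht
      change _ ∈ Set.ofPred _
      rw [mem_ofPred_eq, him]
      exact mul_neg_of_neg_of_pos ht (hpos t)
    exact h1.comp h2

/-- The points off the boundary lying in a bounded component of its complement. -/
def inside {m : ℕ} (v : Polygon Plane m) : Set Plane :=
  {x | x ∉ v.boundary ℝ ∧ IsBounded (connectedComponentIn (v.boundary ℝ)ᶜ x)}

/-- Crossing the edge changes its own contribution by 2π, while the other edges contribute
continuously. Hence the winding function cannot vanish on both sides of a. -/
lemma mem_closure_inside_of_mem_openSegment {m : ℕ} {v : Polygon Plane m} (i : Fin m)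
    (hne : v i ≠ v (finRotate m i)) {a : Plane}
    (ha : a ∈ openSegment ℝ (v i) (v (finRotate m i)))
    (hother : ∀ j ≠ i, a ∉ segment ℝ (v j) (v (finRotate m j))) :
    a ∈ closure (inside v) := by
  classical
  obtain ⟨α, β, hα, hβ, hαβ, rfl⟩ := ha
  set p := v i
  set q := v (finRotate m i)
  set a := α • p + β • q with ha
  set d : ℂ := toC q - toC p with hd
  have hd0 : d ≠ 0 := sub_ne_zero.2 fun h => hne (toC.injective h.symm)
  -- The perpendicular to the edge through a; relative to the edge vector d, the two ends are seen
  -- from `γ t` at α - ti and -β - ti.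
  set γ : ℝ → Plane := fun t => toC.symm (toC a + t * (Complex.I * d)) with hγ
  have hγc : Continuous γ := by
    refine toC.symm.continuous.comp ?_
    fun_prop
  have hγ0 : γ 0 = a := by simp [hγ]
  have hCγ : ∀ t, toC (γ t) = toC a + t * (Complex.I * d) := fun t => by simp [hγ]
  have hCa : toC a = α * toC p + β * toC q := by
    rw [ha, map_add, map_smul, map_smul, Complex.real_smul, Complex.real_smul]
  have hαc : (α : ℂ) = 1 - β := by
    have : α = 1 - β := by linarith
    rw [this]; push_cast; ring
  have hqa : ∀ t, toC q - toC (γ t) = (α - t * Complex.I) * d := by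
    intro t; rw [hCγ, hCa, hd, hαc]; ring
  have hpa : ∀ t, toC p - toC (γ t) = (-β - t * Complex.I) * d := by
    intro t; rw [hCγ, hCa, hd, hαc]; ring
  have hang : ∀ t, angleFrom p q (γ t) =
      Complex.arg ((α - t * Complex.I) / (-β - t * Complex.I)) := by
    intro t
    rw [angleFrom, hqa, hpa, mul_div_mul_right _ _ hd0]
  obtain ⟨hlim1, hlim2⟩ := tendsto_arg_div hα hβ
  set F : Plane → ℝ := fun x => ∑ j ∈ Finset.univ.erase i, angleFrom (v j) (v (finRotate m j)) x
    with hF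
  have hFc : Tendsto (fun t => F (γ t)) (𝓝 0) (𝓝 (F a)) := by
    have h1 : ContinuousAt F a := tendsto_finsetSum _ fun j hj =>
      continuousAt_angleFrom (hother j (Finset.ne_of_mem_erase hj))
    have h2 := hγc.tendsto 0
    rw [hγ0] at h2
    exact h1.tendsto.comp h2
  have hW : ∀ t, winding v (γ t) =
      Complex.arg ((α - t * Complex.I) / (-β - t * Complex.I)) + F (γ t) := by
    intro t
    rw [← hang, hF, winding, ← Finset.add_sum_erase _ _ (Finset.mem_univ i)]
  have hoff : ∀ᶠ t in 𝓝[≠] (0 : ℝ), γ t ∉ v.boundary ℝ := by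
    have h1 : ∀ᶠ t in 𝓝 (0 : ℝ), ∀ j ∈ Finset.univ.erase i,
        γ t ∉ segment ℝ (v j) (v (finRotate m j)) := by
      rw [Finset.eventually_all]
      intro j hj
      have := hγc.tendsto 0
      rw [hγ0] at this
      exact this.eventually ((isCompact_segment _ _).isClosed.isOpen_compl.mem_nhds
        (hother j (Finset.ne_of_mem_erase hj)))
    filter_upwards [nhdsWithin_le_nhds h1, self_mem_nhdsWithin] with t ht ht0 hmem
    obtain ⟨j, hj⟩ := (mem_boundary_iff v _).1 hmem
    rcases eq_or_ne j i with rfl | hji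
    · obtain ⟨r, s, -, -, hrs, h1⟩ := toC_mem_segment.2 hj
      have hrc : (r : ℂ) = 1 - s := by
        have : r = 1 - s := by linarith
        rw [this]; push_cast; ring
      have h2 : d * (r * (-β - t * Complex.I) + s * (α - t * Complex.I)) = 0 := by
        have h3 : (r : ℂ) * toC p + s * toC q = toC (γ t) := h1
        calc _ = r * ((-β - t * Complex.I) * d) + s * ((α - t * Complex.I) * d) := by ring
          _ = _ := by rw [← hqa, ← hpa, ← h3, hrc]; ring
      have h3 := congrArg Complex.im ((mul_eq_zero.1 h2).resolve_left hd0)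
      simp at h3
      exact ht0 (by
        have : (r + s) * t = 0 := by linarith
        rwa [hrs, one_mul] at this)
    · exact ht j (by simp [hji]) hj
  -- If no inside point were near a, the winding function would vanish on both sides, and F a would
  -- have to equal both -π and π.
  by_contra hcl
  have hzero : ∀ᶠ t in 𝓝[≠] (0 : ℝ), winding v (γ t) = 0 := by
    have h1 : ∀ᶠ x in 𝓝 a, x ∉ inside v := by
      have := isClosed_closure.isOpen_compl.mem_nhds hcl
      filter_upwards [this] with x hx hx'
      exact hx (subset_closure hx')
    have h2 := hγc.tendsto 0
    rw [hγ0] at h2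
    filter_upwards [nhdsWithin_le_nhds (h2.eventually h1), hoff] with t ht1 ht2
    by_contra hne
    exact ht1 ⟨ht2, isBounded_component_of_winding_ne_zero ht2 hne⟩
  have hgt : 𝓝[>] (0 : ℝ) ≤ 𝓝[≠] 0 := nhdsWithin_mono _ fun t ht => ne_of_gt ht
  have hlt : 𝓝[<] (0 : ℝ) ≤ 𝓝[≠] 0 := nhdsWithin_mono _ fun t ht => ne_of_lt ht
  have e1 : Real.pi + F a = 0 := by
    refine tendsto_nhds_unique (hlim1.add (hFc.mono_left nhdsWithin_le_nhds)) ?_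
    refine tendsto_const_nhds.congr' ?_
    filter_upwards [hgt hzero] with t ht
    rw [← hW]; exact ht.symm
  have e2 : -Real.pi + F a = 0 := by
    refine tendsto_nhds_unique (hlim2.add (hFc.mono_left nhdsWithin_le_nhds)) ?_
    refine tendsto_const_nhds.congr' ?_
    filter_upwards [hlt hzero] with t ht
    rw [← hW]; exact ht.symm
  have := Real.pi_pos
  linarith

lemma IsSimple.ne_next {m : ℕ} {v : Polygon Plane m} (hv : IsSimple v) (i : Fin m) :
    v i ≠ v (finRotate m i) := by
  obtain ⟨hm, hinj, -⟩ := hv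
  intro h
  have h1 := hinj h
  obtain ⟨k, rfl⟩ : ∃ k, m = k + 1 := ⟨m - 1, by omega⟩
  rw [finRotate_apply] at h1
  have h2 := congrArg Fin.val h1
  rw [Fin.val_add_one] at h2
  split_ifs at h2 with h3
  · rw [h3, Fin.val_last] at h2
    omega
  · omega

lemma IsSimple.eq_or_eq {m : ℕ} {v : Polygon Plane m} (hv : IsSimple v) {i j : Fin m} (hij : i ≠ j)
    {x : Plane} (hi : x ∈ segment ℝ (v i) (v (finRotate m i)))
    (hj : x ∈ segment ℝ (v j) (v (finRotate m j))) : x = v i ∨ x = v (finRotate m i) := by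
  rw [← edgeSet_eq_segment] at hi hj
  simpa using (hv.2.2 i j hij ⟨hi, hj⟩).1

lemma IsSimple.region_subset_closure_inside {m : ℕ} {v : Polygon Plane m} (hv : IsSimple v) :
    region v ⊆ closure (inside v) := by
  rintro a (ha | ha)
  · obtain ⟨i, hi⟩ := (mem_boundary_iff v a).1 ha
    rw [← closure_openSegment] at hi
    refine closure_minimal (fun b hb => ?_) isClosed_closure hi
    refine mem_closure_inside_of_mem_openSegment i (hv.ne_next i) hb fun j hji hj => ?_
    rcases hv.eq_or_eq hji.symm (openSegment_subset_segment _ _ _ hb) hj with rfl | rfl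
    · exact hv.ne_next i (left_mem_openSegment_iff.1 hb)
    · exact hv.ne_next i (right_mem_openSegment_iff.1 hb)
  · exact subset_closure ha

/-! ### Affine functionals -/

/-- The affine functional `z ↦ α * z 0 + β * z 1 + γ`. -/
noncomputable def aff (α β γ : ℝ) : Plane →ᵃ[ℝ] ℝ :=
  ((α • (EuclideanSpace.proj 0 : Plane →L[ℝ] ℝ) + β • (EuclideanSpace.proj 1 : Plane →L[ℝ] ℝ) :
    Plane →L[ℝ] ℝ) : Plane →ₗ[ℝ] ℝ).toAffineMap + AffineMap.const ℝ Plane γ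

@[simp] lemma aff_apply (α β γ : ℝ) (z : Plane) : aff α β γ z = α * z 0 + β * z 1 + γ := by
  simp [aff]

lemma exists_of_mem_segment {p q x : Plane} (h : x ∈ segment ℝ p q) :
    ∃ s t : ℝ, 0 ≤ s ∧ 0 ≤ t ∧ s + t = 1 ∧ x = s • p + t • q ∧
      ∀ f : Plane →ᵃ[ℝ] ℝ, f x = s * f p + t * f q := by
  obtain ⟨s, t, hs, ht, hst, rfl⟩ := h
  exact ⟨s, t, hs, ht, hst, rfl, fun f => by
    rw [Convex.combo_affine_apply hst, smul_eq_mul, smul_eq_mul]⟩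

lemma nonneg_of_mem_segment {f : Plane →ᵃ[ℝ] ℝ} {p q x : Plane} (h : x ∈ segment ℝ p q)
    (hp : 0 ≤ f p) (hq : 0 ≤ f q) : 0 ≤ f x := by
  obtain ⟨s, t, hs, ht, -, -, hf⟩ := exists_of_mem_segment h
  rw [hf]
  positivity

lemma nonpos_of_mem_segment {f : Plane →ᵃ[ℝ] ℝ} {p q x : Plane} (h : x ∈ segment ℝ p q)
    (hp : f p ≤ 0) (hq : f q ≤ 0) : f x ≤ 0 := by
  have := nonneg_of_mem_segment (f := -f) h (by simpa using hp) (by simpa using hq)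
  simpa using this

lemma pos_of_mem_segment {f : Plane →ᵃ[ℝ] ℝ} {p q x : Plane} (h : x ∈ segment ℝ p q)
    (hp : 0 < f p) (hq : 0 < f q) : 0 < f x := by
  obtain ⟨s, t, hs, ht, hst, -, hf⟩ := exists_of_mem_segment h
  rw [hf]
  rcases hs.eq_or_lt with rfl | hs
  · rw [zero_add] at hst
    simpa [hst] using hq
  · positivity

lemma continuous_affineMap (f : Plane →ᵃ[ℝ] ℝ) : Continuous f :=
  f.continuous_of_finiteDimensional

/-- The intermediate value theorem for min(f, g) along the segment gives the point where it leaves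
the wedge. -/
lemma exists_exit (f g : Plane →ᵃ[ℝ] ℝ) {z p : Plane} (hf : 0 < f z) (hg : 0 < g z)
    (hp : ¬ (0 ≤ f p ∧ 0 ≤ g p)) :
    ∃ w ∈ segment ℝ z p, 0 ≤ f w ∧ 0 ≤ g w ∧ (f w = 0 ∨ g w = 0) := by
  have hc : ContinuousOn (fun w => min (f w) (g w)) (segment ℝ z p) :=
    ((continuous_affineMap f).min (continuous_affineMap g)).continuousOn
  have hp' : min (f p) (g p) ≤ 0 := by
    by_contra! h
    exact hp ⟨(lt_min_iff.1 h).1.le, (lt_min_iff.1 h).2.le⟩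
  obtain ⟨w, hw, hw0⟩ := (convex_segment z p).isPreconnected.intermediate_value
    (right_mem_segment ℝ z p) (left_mem_segment ℝ z p) hc ⟨hp', (lt_min hf hg).le⟩
  have hw0' : min (f w) (g w) = 0 := hw0
  refine ⟨w, hw, hw0' ▸ min_le_left _ _, hw0' ▸ min_le_right _ _, ?_⟩
  rcases min_choice (f w) (g w) with h | h
  · exact Or.inl (h ▸ hw0')
  · exact Or.inr (h ▸ hw0')

lemma exists_coordinates {a x p : Plane}
    (hD : (x 0 - a 0) * (p 1 - a 1) - (x 1 - a 1) * (p 0 - a 0) ≠ 0) :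
    ∃ μ ν : Plane →ᵃ[ℝ] ℝ, (∀ z, z = (1 - μ z - ν z) • a + μ z • x + ν z • p) ∧
      μ a = 0 ∧ ν a = 0 ∧ μ x = 1 ∧ ν x = 0 ∧ μ p = 0 ∧ ν p = 1 := by
  set D := (x 0 - a 0) * (p 1 - a 1) - (x 1 - a 1) * (p 0 - a 0) with hDdef
  refine ⟨aff ((p 1 - a 1) / D) (-(p 0 - a 0) / D) (((p 0 - a 0) * a 1 - (p 1 - a 1) * a 0) / D),
    aff (-(x 1 - a 1) / D) ((x 0 - a 0) / D) (((x 1 - a 1) * a 0 - (x 0 - a 0) * a 1) / D),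
    fun z => ?_, ?_, ?_, ?_, ?_, ?_, ?_⟩
  · ext k
    fin_cases k <;> simp <;> field_simp <;> rw [hDdef] <;> ring
  all_goals simp; field_simp; try rw [hDdef]
  all_goals ring

lemma mem_convexHull_triple {a b c z : Plane} {r s t : ℝ} (hr : 0 ≤ r) (hs : 0 ≤ s) (ht : 0 ≤ t)
    (h : r + s + t = 1) (hz : z = r • a + s • b + t • c) : z ∈ convexHull ℝ {a, b, c} := by
  have := (convex_convexHull ℝ ({a, b, c} : Set Plane)).sum_mem (t := Finset.univ)
    (w := ![r, s, t]) (z := ![a, b, c]) (by intro i _; fin_cases i <;> simpa)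
    (by simpa [Fin.sum_univ_three] using h)
    (by intro i _; fin_cases i <;> exact subset_convexHull ℝ _ (by simp))
  simpa [Fin.sum_univ_three, hz] using this

/-! ### Points seeing vertices -/

lemma vertex_mem_boundary {m : ℕ} (v : Polygon Plane m) (i : Fin m) : v i ∈ v.boundary ℝ :=
  segment_subset_boundary v i (left_mem_segment _ _ _)

/-- Here a and p lie on the same side of x, so the line of sight would run along the edge for a
while before x. -/
lemma false_of_segment_overlap {m : ℕ} {v : Polygon Plane m} {a x p : Plane} {r : ℝ} (hr : 0 < r)
    (hax : a = x + r • (p - x)) (hpx : p ≠ x) (hsub : segment ℝ x p ⊆ v.boundary ℝ)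
    (hfree : ∀ y ∈ segment ℝ a x, y ∈ v.boundary ℝ → y = x) : False := by
  have hk : 0 < min r 1 := lt_min hr one_pos
  have h1 : x + (min r 1) • (p - x) ∈ segment ℝ x p := by
    rw [segment_eq_image']
    exact ⟨min r 1, ⟨hk.le, min_le_right _ _⟩, rfl⟩
  have h2 : x + (min r 1) • (p - x) ∈ segment ℝ a x := by
    rw [segment_symm, segment_eq_image']
    refine ⟨min r 1 / r, ⟨by positivity, (div_le_one hr).2 (min_le_left _ _)⟩, ?_⟩
    simp only [hax, add_sub_cancel_left, smul_smul]
    rw [div_mul_cancel₀ _ hr.ne']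
  have h3 := hfree _ h2 (hsub h1)
  rw [add_eq_left, smul_eq_zero] at h3
  exact h3.elim hk.ne' (sub_ne_zero.2 hpx)

set_option maxHeartbeats 1000000 in
/-- Rotating a line of sight that ends in the relative interior of an edge towards an end of that
edge, one meets a visible vertex. -/
lemma exists_visible_vertex {m : ℕ} {v : Polygon Plane m} (hv : IsSimple v) {a x p q : Plane}
    (ha : a ∉ v.boundary ℝ) (hb : IsBounded (connectedComponentIn (v.boundary ℝ)ᶜ a))
    (hfree : ∀ y ∈ segment ℝ a x, y ∈ v.boundary ℝ → y = x) (hxv : x ∉ range v.vertices)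
    (i : Fin m) (hpq : segment ℝ p q = segment ℝ (v i) (v (finRotate m i)))
    (hp : p ∈ range v.vertices) (hq : q ∈ range v.vertices) (hx : x ∈ segment ℝ p q) :
    ∃ s ∈ range v.vertices, s ∈ convexHull ℝ {a, x, p} ∧ segment ℝ a s ⊆ region v := by
  have hpqb : segment ℝ p q ⊆ v.boundary ℝ := hpq ▸ segment_subset_boundary v i
  have hpx : p ≠ x := fun h => hxv (h ▸ hp)
  have hqx : q ≠ x := fun h => hxv (h ▸ hq)
  have hxpb : segment ℝ x p ⊆ v.boundary ℝ :=
    ((convex_segment p q).segment_subset hx (left_mem_segment _ _ _)).trans hpqb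
  have hxqb : segment ℝ x q ⊆ v.boundary ℝ :=
    ((convex_segment p q).segment_subset hx (right_mem_segment _ _ _)).trans hpqb
  obtain ⟨α, β, hα, hβ, hαβ, hxe, hxf⟩ := exists_of_mem_segment hx
  have hα : 0 < α := hα.lt_of_ne (by
    rintro rfl
    rw [zero_add] at hαβ
    simp [hαβ] at hxe
    exact hqx hxe.symm)
  have hβ : 0 < β := hβ.lt_of_ne (by
    rintro rfl
    rw [add_zero] at hαβ
    simp [hαβ] at hxe
    exact hpx hxe.symm)
  -- Were a on the line of the edge, the line of sight would overlap the half of the edge towards p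
  -- or the half towards q. So a, x, p serve as an affine frame.
  have hD : (x 0 - a 0) * (p 1 - a 1) - (x 1 - a 1) * (p 0 - a 0) ≠ 0 := by
    intro hD
    have hcol : ∃ r : ℝ, a = x + r • (p - x) := by
      have h01 : p 0 - x 0 ≠ 0 ∨ p 1 - x 1 ≠ 0 := by
        by_contra! h
        apply hpx
        ext k
        fin_cases k
        · exact sub_eq_zero.1 h.1
        · exact sub_eq_zero.1 h.2
      rcases h01 with h | h
      · refine ⟨(a 0 - x 0) / (p 0 - x 0), ?_⟩
        ext k
        fin_cases k <;> simp <;> field_simp <;> linarith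
      · refine ⟨(a 1 - x 1) / (p 1 - x 1), ?_⟩
        ext k
        fin_cases k <;> simp <;> field_simp <;> linarith
    obtain ⟨r, hr⟩ := hcol
    rcases lt_trichotomy r 0 with h | h | h
    · have hxq : a = x + (-r * (β / α)) • (q - x) := by
        have hp2 : α • (p - x) = -(β • (q - x)) := by
          have : x = α • x + β • x := by rw [← add_smul, hαβ, one_smul]
          rw [smul_sub, smul_sub]
          rw [← sub_eq_zero]
          calc _ = (α • p + β • q) - (α • x + β • x) := by abel
            _ = 0 := by rw [← hxe, ← this, sub_self]
        have hp3 : p - x = (-(β / α)) • (q - x) := by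
          rw [neg_smul, div_eq_inv_mul, mul_smul, ← smul_neg, ← hp2, smul_smul,
            inv_mul_cancel₀ hα.ne', one_smul]
        rw [hr, hp3, smul_smul]
        congr 2
        ring
      exact false_of_segment_overlap (mul_pos (neg_pos.2 h) (div_pos hβ hα)) hxq hqx hxqb hfree
    · rw [h, zero_smul, add_zero] at hr
      exact ha (hr ▸ hpqb hx)
    · exact false_of_segment_overlap h hr hpx hxpb hfree
  obtain ⟨μ, ν, hz, hμa, hνa, hμx, hνx, hμp, hνp⟩ := exists_coordinates hD
  have hvb : ∀ s ∈ range v.vertices, s ∈ v.boundary ℝ := by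
    rintro _ ⟨j, rfl⟩
    exact vertex_mem_boundary v j
  have hline : ∀ w, ν w = 0 → 0 ≤ μ w → μ w ≤ 1 → w ∈ segment ℝ a x := by
    intro w h1 h2 h3
    refine ⟨1 - μ w, μ w, by linarith, h2, by ring, ?_⟩
    conv_rhs => rw [hz w]
    simp [h1]
  -- The vertices in the triangle axp. The quotient minimised next grows with the angle at a
  -- measured from the ray ax, so `s₀` is a vertex met first when the line of sight rotates.
  set V : Set Plane := {s | s ∈ range v.vertices ∧ 0 ≤ μ s ∧ 0 ≤ ν s ∧ μ s + ν s ≤ 1} with hV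
  have hVfin : V.Finite := (finite_range v.vertices).subset fun s hs => hs.1
  have hVne : V.Nonempty := ⟨p, hp, by simp [hμp], by simp [hνp], by simp [hμp, hνp]⟩
  obtain ⟨s₀, hs₀, hmin⟩ := hVfin.exists_minimalFor (fun s => ν s / (μ s + ν s)) V hVne
  have hVpos : ∀ s ∈ V, 0 < μ s + ν s := by
    intro s hs
    refine (add_nonneg hs.2.1 hs.2.2.1).lt_of_ne fun h => ?_
    have h1 : ν s = 0 := by linarith [hs.2.1, hs.2.2.1]
    have h2 : μ s = 0 := by linarith
    have h3 := hz s
    simp [h1, h2] at h3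
    exact ha (h3 ▸ hvb s hs.1)
  set t₀ := ν s₀ / (μ s₀ + ν s₀) with ht₀
  have hs₀pos := hVpos s₀ hs₀
  have hν₀ : 0 < ν s₀ := by
    refine hs₀.2.2.1.lt_of_ne fun h => ?_
    have h1 := hline s₀ h.symm hs₀.2.1 (by linarith [hs₀.2.2.2])
    exact hxv (hfree _ h1 (hvb _ hs₀.1) ▸ hs₀.1)
  have ht₀pos : 0 < t₀ := div_pos hν₀ hs₀pos
  have ht₀le : t₀ ≤ 1 := (div_le_one hs₀pos).2 (by linarith [hs₀.2.1])
  set l₂ : Plane →ᵃ[ℝ] ℝ := AffineMap.const ℝ Plane 1 - μ - ν with hl₂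
  set l₃ : Plane →ᵃ[ℝ] ℝ := t₀ • (μ + ν) - ν with hl₃
  have hl₂' : ∀ w, l₂ w = 1 - μ w - ν w := fun w => by simp [hl₂]
  have hl₃' : ∀ w, l₃ w = t₀ * (μ w + ν w) - ν w := fun w => by
    simp [hl₃]
    ring
  have hVl : ∀ s ∈ V, l₃ s ≤ 0 := by
    intro s hs
    have h1 : t₀ ≤ ν s / (μ s + ν s) := by
      rcases le_total t₀ (ν s / (μ s + ν s)) with h | h
      · exact h
      · exact hmin hs h
    rw [le_div_iff₀ (hVpos s hs)] at h1
    rw [hl₃']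
    linarith
  have hμ_pos : ∀ w, 0 ≤ ν w → 0 < l₃ w → 0 < μ w := by
    intro w h1 h2
    rw [hl₃'] at h2
    nlinarith
  have hedge : ∀ w ∈ segment ℝ p q, l₂ w = 0 := by
    have h1 := hxf μ
    have h2 := hxf ν
    rw [hμx, hμp] at h1
    rw [hνx, hνp] at h2
    have hl₂q : l₂ q = 0 := by
      rw [hl₂']
      have : β * (1 - μ q - ν q) = 0 := by linarith
      exact (mul_eq_zero.1 this).resolve_left hβ.ne'
    have hl₂p : l₂ p = 0 := by rw [hl₂', hμp, hνp]; ring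
    intro w hw
    exact le_antisymm (nonpos_of_mem_segment hw hl₂p.le hl₂q.le)
      (nonneg_of_mem_segment hw hl₂p.ge hl₂q.ge)
  -- The triangle swept before `s₀` is met: between the rays from a through x and `s₀`, strictly
  -- before the line of the edge.
  set T : Set Plane := {z | 0 ≤ ν z ∧ 0 < l₂ z ∧ 0 < l₃ z} with hT
  have hTconv : Convex ℝ T :=
    ((convex_Ici 0).affine_preimage ν).inter
      (((convex_Ioi 0).affine_preimage l₂).inter ((convex_Ioi 0).affine_preimage l₃))
  have hTdisj : Disjoint T (v.boundary ℝ) := by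
    rw [disjoint_left]
    rintro z ⟨hz1, hz2, hz3⟩ hzb
    obtain ⟨j, hj⟩ := (mem_boundary_iff v z).1 hzb
    have hji : j ≠ i := by
      rintro rfl
      rw [← hpq] at hj
      exact hz2.ne' (hedge z hj)
    have hzν : 0 < ν z := by
      refine hz1.lt_of_ne fun h => ?_
      rw [hl₂'] at hz2
      have h1 := hfree z (hline z h.symm (hμ_pos z hz1 hz3).le (by linarith)) hzb
      rw [h1, hμx, hνx] at hz2
      linarith
    -- An edge through z in T cannot end on the swept side of the ray to `s₀`. An end inside the
    -- triangle would beat `s₀`; otherwise the edge leaves through ax, hence at x, or through xp,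
    -- hence at a vertex that beats `s₀`. Both ends being beyond the ray contradicts z in T.
    have key : ∀ p' ∈ segment ℝ (v j) (v (finRotate m j)), p' ∈ range v.vertices →
        l₃ p' ≤ 0 := by
      intro p' hp' hp'v
      by_contra! hpos
      have hout : ¬ (0 ≤ ν p' ∧ 0 ≤ l₂ p') := by
        rintro ⟨h1, h2⟩
        rw [hl₂'] at h2
        exact hpos.not_ge (hVl p' ⟨hp'v, (hμ_pos p' h1 hpos).le, h1, by linarith⟩)
      obtain ⟨w, hw, hw1, hw2, hw3⟩ := exists_exit ν l₂ hzν hz2 hout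
      have hwpos : 0 < l₃ w := pos_of_mem_segment hw hz3 hpos
      have hwμ := hμ_pos w hw1 hwpos
      have hwj : w ∈ segment ℝ (v j) (v (finRotate m j)) :=
        (convex_segment _ _).segment_subset hj hp' hw
      rcases hw3 with h | h
      · rw [hl₂'] at hw2
        have hwx := hfree w (hline w h hwμ.le (by linarith)) (segment_subset_boundary v j hwj)
        rw [hwx] at hwj
        rcases hv.eq_or_eq hji hwj (hpq ▸ hx) with h1 | h1
        · exact hxv ⟨_, h1.symm⟩
        · exact hxv ⟨_, h1.symm⟩
      · rw [hl₂'] at h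
        have hwe : w ∈ segment ℝ p q := by
          refine (convex_segment p q).segment_subset hx (left_mem_segment _ _ _)
            ⟨μ w, ν w, hwμ.le, hw1, by linarith, ?_⟩
          conv_rhs => rw [hz w]
          rw [h, zero_smul, zero_add]
        have hwv : w ∈ range v.vertices := by
          rcases hv.eq_or_eq hji hwj (hpq ▸ hwe) with h1 | h1
          · exact ⟨_, h1.symm⟩
          · exact ⟨_, h1.symm⟩
        exact hwpos.not_ge (hVl w ⟨hwv, hwμ.le, hw1, by linarith⟩)
    exact hz3.not_ge (nonpos_of_mem_segment hj
      (key _ (left_mem_segment _ _ _) ⟨_, rfl⟩) (key _ (right_mem_segment _ _ _) ⟨_, rfl⟩))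
  obtain ⟨c, hc⟩ : ∃ c, c = midpoint ℝ a x := ⟨_, rfl⟩
  have hcseg : c ∈ segment ℝ a x := hc ▸ midpoint_mem_segment a x
  have hcf : ∀ f : Plane →ᵃ[ℝ] ℝ, f c = (f a + f x) / 2 := by
    intro f
    rw [hc, f.map_midpoint, midpoint_eq_smul_add, smul_eq_mul, invOf_eq_inv]
    ring
  have hcμ : μ c = 1 / 2 := by rw [hcf, hμa, hμx]; norm_num
  have hcν : ν c = 0 := by rw [hcf, hνa, hνx]; norm_num
  have hcT : c ∈ T := by
    refine ⟨hcν.ge, ?_, ?_⟩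
    · rw [hl₂', hcμ, hcν]; norm_num
    · rw [hl₃', hcμ, hcν]; linarith
  have hccomp : c ∈ connectedComponentIn (v.boundary ℝ)ᶜ a := by
    have hsub : segment ℝ a c ⊆ (v.boundary ℝ)ᶜ := by
      intro y hy hyb
      have h1 := hfree y ((convex_segment a x).segment_subset (left_mem_segment _ _ _) hcseg hy) hyb
      have h2 := nonneg_of_mem_segment (f := l₂) hy (by rw [hl₂', hμa, hνa]; norm_num)
        (by rw [hl₂', hcμ, hcν]; norm_num)
      obtain ⟨s, t, hs, ht, hst, -, hf⟩ := exists_of_mem_segment hy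
      have h3 := hf μ
      rw [h1, hμx, hμa, hcμ] at h3
      linarith
    exact (convex_segment a c).isPreconnected.subset_connectedComponentIn
      (left_mem_segment _ _ _) hsub (right_mem_segment _ _ _)
  have hTcomp : T ⊆ connectedComponentIn (v.boundary ℝ)ᶜ a := by
    rw [connectedComponentIn_eq hccomp]
    exact hTconv.isPreconnected.subset_connectedComponentIn hcT hTdisj.subset_compl_right
  refine ⟨s₀, hs₀.1, mem_convexHull_triple (by linarith [hs₀.2.2.2]) hs₀.2.1 hs₀.2.2.1 (by ring)
    (hz s₀), fun w hw => ?_⟩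
  -- Further vertices may lie on the segment from a to `s₀`; it belongs to the region anyway, as a
  -- limit of T.
  apply closure_subset_region hb hTcomp
  have hwν : 0 ≤ ν w := nonneg_of_mem_segment hw hνa.ge hν₀.le
  have hwl₂ : 0 ≤ l₂ w := nonneg_of_mem_segment hw (by rw [hl₂', hμa, hνa]; norm_num)
    (by rw [hl₂']; linarith [hs₀.2.2.2])
  have hwl₃ : 0 ≤ l₃ w := nonneg_of_mem_segment hw (by rw [hl₃', hμa, hνa]; norm_num)
    (by rw [hl₃', ht₀, div_mul_cancel₀ _ hs₀pos.ne', sub_self])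
  have hsub : openSegment ℝ c w ⊆ T := by
    rintro _ ⟨s, t, hs, ht, hst, rfl⟩
    have hf : ∀ f : Plane →ᵃ[ℝ] ℝ, f (s • c + t • w) = s * f c + t * f w := fun f => by
      rw [Convex.combo_affine_apply hst, smul_eq_mul, smul_eq_mul]
    have h1 := mul_pos hs hcT.2.1
    have h2 := mul_pos hs hcT.2.2
    exact ⟨by rw [hf, hcν]; positivity, by rw [hf]; positivity, by rw [hf]; positivity⟩
  have := closure_mono hsub
  rw [closure_openSegment] at this
  exact this (right_mem_segment _ _ _)

/-! ### Interior points guard when the hull is a triangle -/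

/-- The first vertex of the reference triangle. -/
noncomputable def pA : Plane := !₂[0, 1]

/-- The second vertex of the reference triangle. -/
noncomputable def pB : Plane := !₂[1, 0]

/-- The third vertex of the reference triangle. -/
noncomputable def pC : Plane := !₂[0, -1]

/-- The barycentric coordinate at `pA`. -/
noncomputable def fA : Plane →ᵃ[ℝ] ℝ := aff (-1 / 2) (1 / 2) (1 / 2)

/-- The barycentric coordinate at `pB`. -/
noncomputable def fB : Plane →ᵃ[ℝ] ℝ := aff 1 0 0

/-- The barycentric coordinate at `pC`. -/
noncomputable def fC : Plane →ᵃ[ℝ] ℝ := aff (-1 / 2) (-1 / 2) (1 / 2)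

@[simp] lemma fA_pA : fA pA = 1 := by simp [fA, pA]; norm_num
@[simp] lemma fA_pB : fA pB = 0 := by simp [fA, pB]; norm_num
@[simp] lemma fA_pC : fA pC = 0 := by simp [fA, pC]
@[simp] lemma fB_pA : fB pA = 0 := by simp [fB, pA]
@[simp] lemma fB_pB : fB pB = 1 := by simp [fB, pB]
@[simp] lemma fB_pC : fB pC = 0 := by simp [fB, pC]
@[simp] lemma fC_pA : fC pA = 0 := by simp [fC, pA]; norm_num
@[simp] lemma fC_pB : fC pB = 0 := by simp [fC, pB]; norm_num
@[simp] lemma fC_pC : fC pC = 1 := by simp [fC, pC]; norm_num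

lemma fA_add_fB_add_fC (z : Plane) : fA z + fB z + fC z = 1 := by
  simp [fA, fB, fC]; ring

lemma eq_barycentric (z : Plane) : z = fA z • pA + fB z • pB + fC z • pC := by
  ext k
  fin_cases k <;> simp [fA, fB, fC, pA, pB, pC]
  ring

/-- The vertices of the reference triangle. -/
def corners : Set Plane := {pA, pB, pC}

/-- The reference triangle. -/
def triangle : Set Plane := {z | 0 ≤ fA z ∧ 0 ≤ fB z ∧ 0 ≤ fC z}

lemma convex_triangle : Convex ℝ triangle :=
  ((convex_Ici 0).affine_preimage fA).inter
    (((convex_Ici 0).affine_preimage fB).inter ((convex_Ici 0).affine_preimage fC))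

lemma corners_subset_triangle : corners ⊆ triangle := by
  rintro z (rfl | rfl | rfl) <;> simp [triangle]

lemma convexHull_corners : convexHull ℝ corners = triangle :=
  (convexHull_min corners_subset_triangle convex_triangle).antisymm fun z hz =>
    mem_convexHull_triple hz.1 hz.2.1 hz.2.2 (fA_add_fB_add_fC z) (eq_barycentric z)

lemma convexHull_eq_triangle {S : Set Plane} (h1 : corners ⊆ S) (h2 : S ⊆ triangle) :
    convexHull ℝ S = triangle :=
  (convexHull_min h2 convex_triangle).antisymm (convexHull_corners ▸ convexHull_mono h1)

lemma affineIndependent_corners : AffineIndependent ℝ ![pA, pB, pC] := by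
  rw [affineIndependent_iff_not_collinear_set, collinear_iff_of_mem (p₀ := pA) (by simp)]
  rintro ⟨d, hd⟩
  obtain ⟨r, hr⟩ := hd pB (by simp)
  obtain ⟨s, hs⟩ := hd pC (by simp)
  have h1 := congrArg (fun z : Plane => z 0) hr
  have h2 := congrArg (fun z : Plane => z 0) hs
  have h3 := congrArg (fun z : Plane => z 1) hs
  simp [pA, pB, pC] at h1 h2 h3
  rcases h2 with h | h <;> simp [h] at h1 h3
  norm_num at h3

lemma eq_pA_of_mem_triangle {z : Plane} (hz : z ∈ triangle) (h : 1 ≤ fA z) : z = pA := by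
  have h1 := fA_add_fB_add_fC z
  obtain ⟨h2, h3, h4⟩ := hz
  rw [eq_barycentric z, show fA z = 1 by linarith, show fB z = 0 by linarith,
    show fC z = 0 by linarith]
  simp

lemma eq_pB_of_mem_triangle {z : Plane} (hz : z ∈ triangle) (h : 1 ≤ fB z) : z = pB := by
  have h1 := fA_add_fB_add_fC z
  obtain ⟨h2, h3, h4⟩ := hz
  rw [eq_barycentric z, show fA z = 0 by linarith, show fB z = 1 by linarith,
    show fC z = 0 by linarith]
  simp

lemma eq_pC_of_mem_triangle {z : Plane} (hz : z ∈ triangle) (h : 1 ≤ fC z) : z = pC := by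
  have h1 := fA_add_fB_add_fC z
  obtain ⟨h2, h3, h4⟩ := hz
  rw [eq_barycentric z, show fA z = 0 by linarith, show fB z = 0 by linarith,
    show fC z = 1 by linarith]
  simp

lemma mem_extremePoints_triangle {p : Plane} {f : Plane →ᵃ[ℝ] ℝ} (hp : p ∈ triangle)
    (hfp : f p = 1) (hle : ∀ z ∈ triangle, f z ≤ 1) (heq : ∀ z ∈ triangle, 1 ≤ f z → z = p) :
    p ∈ extremePoints ℝ triangle := by
  rw [mem_extremePoints]
  refine ⟨hp, ?_⟩
  rintro x hx y hy ⟨s, t, hs, ht, hst, hsum⟩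
  have h1 := Convex.combo_affine_apply (f := f) (x := x) (y := y) hst
  rw [hsum, hfp, smul_eq_mul, smul_eq_mul] at h1
  have h2 := hle x hx
  have h3 := hle y hy
  exact ⟨heq x hx (by nlinarith), heq y hy (by nlinarith)⟩

lemma extremePoints_triangle : extremePoints ℝ triangle = corners := by
  apply subset_antisymm
  · rw [← convexHull_corners]
    exact extremePoints_convexHull_subset
  · have hle : ∀ z ∈ triangle, fA z ≤ 1 ∧ fB z ≤ 1 ∧ fC z ≤ 1 := by
      rintro z ⟨h2, h3, h4⟩
      have h1 := fA_add_fB_add_fC z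
      refine ⟨?_, ?_, ?_⟩ <;> linarith
    rintro p (rfl | rfl | rfl)
    · exact mem_extremePoints_triangle (corners_subset_triangle (by simp [corners])) fA_pA
        (fun z hz => (hle z hz).1) fun z hz => eq_pA_of_mem_triangle hz
    · exact mem_extremePoints_triangle (corners_subset_triangle (by simp [corners])) fB_pB
        (fun z hz => (hle z hz).2.1) fun z hz => eq_pB_of_mem_triangle hz
    · exact mem_extremePoints_triangle (corners_subset_triangle (by simp [corners])) fC_pC
        (fun z hz => (hle z hz).2.2) fun z hz => eq_pC_of_mem_triangle hz

lemma interiorPoints_eq {S : Finset Plane} (h1 : corners ⊆ S) (h2 : (S : Set Plane) ⊆ triangle) :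
    interiorPoints S = (S : Set Plane) \ corners := by
  rw [interiorPoints, convexHull_eq_triangle h1 h2, extremePoints_triangle]

lemma exists_side {p q : Plane} (hp : p ∈ corners) (hq : q ∈ corners) (hpq : p ≠ q) :
    ∃ f : Plane →ᵃ[ℝ] ℝ, f p = 0 ∧ f q = 0 ∧ (∀ z ∈ triangle, 0 ≤ f z) ∧
      ∀ z ∈ triangle, f z = 0 → z ∈ segment ℝ p q := by
  have hAB : ∀ z ∈ triangle, fC z = 0 → z ∈ segment ℝ pA pB := fun z hz h =>
    ⟨fA z, fB z, hz.1, hz.2.1, by linarith [fA_add_fB_add_fC z], by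
      conv_rhs => rw [eq_barycentric z]
      simp [h]⟩
  have hBC : ∀ z ∈ triangle, fA z = 0 → z ∈ segment ℝ pB pC := fun z hz h =>
    ⟨fB z, fC z, hz.2.1, hz.2.2, by linarith [fA_add_fB_add_fC z], by
      conv_rhs => rw [eq_barycentric z]
      simp [h]⟩
  have hAC : ∀ z ∈ triangle, fB z = 0 → z ∈ segment ℝ pA pC := fun z hz h =>
    ⟨fA z, fC z, hz.1, hz.2.2, by linarith [fA_add_fB_add_fC z], by
      conv_rhs => rw [eq_barycentric z]
      simp [h]⟩
  rcases hp with rfl | rfl | rfl <;> rcases hq with rfl | rfl | rfl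
  · exact absurd rfl hpq
  · exact ⟨fC, by simp, by simp, fun z hz => hz.2.2, hAB⟩
  · exact ⟨fB, by simp, by simp, fun z hz => hz.2.1, hAC⟩
  · exact ⟨fC, by simp, by simp, fun z hz => hz.2.2, fun z hz h => segment_symm ℝ pA pB ▸ hAB z hz h⟩
  · exact absurd rfl hpq
  · exact ⟨fA, by simp, by simp, fun z hz => hz.1, hBC⟩
  · exact ⟨fB, by simp, by simp, fun z hz => hz.2.1, fun z hz h => segment_symm ℝ pA pC ▸ hAC z hz h⟩
  · exact ⟨fA, by simp, by simp, fun z hz => hz.1, fun z hz h => segment_symm ℝ pB pC ▸ hBC z hz h⟩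
  · exact absurd rfl hpq

lemma nonneg_of_mem_boundary {m : ℕ} {v : Polygon Plane m} {f : Plane →ᵃ[ℝ] ℝ}
    (hf : ∀ i, 0 ≤ f (v i)) {x : Plane} (hx : x ∈ v.boundary ℝ) : 0 ≤ f x := by
  obtain ⟨i, hi⟩ := (mem_boundary_iff v x).1 hx
  exact nonneg_of_mem_segment hi (hf _) (hf _)

/-- The open half-plane f < 0 misses the chain and contains the ray from a pointing away from a
vertex, so it is outside. -/
lemma nonneg_of_mem_region {m : ℕ} {v : Polygon Plane m} {f : Plane →ᵃ[ℝ] ℝ} (i : Fin m)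
    (hf : ∀ i, 0 ≤ f (v i)) {a : Plane} (ha : a ∈ region v) : 0 ≤ f a := by
  by_contra! hneg
  refine notMem_region_of_not_isBounded (T := {z | f z < 0})
    ((convex_Iio 0).affine_preimage f).isPreconnected
    (disjoint_left.2 fun z hz hzb => (nonneg_of_mem_boundary hf hzb).not_gt hz) hneg
    (not_isBounded_of_ray (x := a) (d := a - v i) ?_ fun t ht => ?_) ha
  · rw [sub_ne_zero]
    rintro rfl
    exact hneg.not_ge (hf i)
  · have h1 : a + t • (a - v i) = AffineMap.lineMap a (v i) (-t) := by
      rw [AffineMap.lineMap_apply, vsub_eq_sub, vadd_eq_add, ← neg_sub, smul_neg, neg_smul, add_comm]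
    change f _ < 0
    rw [h1, AffineMap.apply_lineMap, AffineMap.lineMap_apply]
    have := mul_nonneg ht (hf i)
    simp
    nlinarith

/-- Visibility is an intersection of closed conditions, one for each parameter along the segment. -/
lemma isClosed_visibleRegion {P : Set Plane} (hP : IsClosed P) (g : Plane) :
    IsClosed (visibleRegion P g) := by
  have : visibleRegion P g = P ∩ ⋂ t ∈ Icc (0 : ℝ) 1, {a | AffineMap.lineMap g a t ∈ P} := by
    ext a
    change a ∈ P ∧ segment ℝ g a ⊆ P ↔ _
    rw [segment_eq_image_lineMap]
    simp only [image_subset_iff, mem_inter_iff, mem_iInter₂]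
    rfl
  rw [this]
  refine hP.inter (isClosed_biInter fun t _ => hP.preimage ?_)
  simp only [AffineMap.lineMap_apply, vsub_eq_sub, vadd_eq_add]
  fun_prop

set_option maxHeartbeats 1000000 in
lemma exists_visible_of_mem_inside {m : ℕ} {v : Polygon Plane m} (hv : IsSimple v)
    (hr : range v.vertices ⊆ triangle) {g : Plane} (hg : g ∈ range v.vertices \ corners)
    {a : Plane} (ha : a ∈ inside v) :
    ∃ s ∈ range v.vertices \ corners, segment ℝ a s ⊆ region v := by
  obtain ⟨ha1, hb⟩ := ha
  have hareg : a ∈ region v := Or.inr ⟨ha1, hb⟩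
  have hvert : ∀ f : Plane →ᵃ[ℝ] ℝ, (∀ z ∈ triangle, 0 ≤ f z) → ∀ i, 0 ≤ f (v i) :=
    fun f hf i => hf _ (hr ⟨i, rfl⟩)
  obtain ⟨i₀, hi₀⟩ := hg.1
  have hatri : a ∈ triangle :=
    ⟨nonneg_of_mem_region i₀ (hvert _ fun z hz => hz.1) hareg,
      nonneg_of_mem_region i₀ (hvert _ fun z hz => hz.2.1) hareg,
      nonneg_of_mem_region i₀ (hvert _ fun z hz => hz.2.2) hareg⟩
  have hgb : g ∈ v.boundary ℝ := hi₀ ▸ vertex_mem_boundary v i₀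
  obtain ⟨x, hxag, hxb, hfree⟩ : ∃ x ∈ segment ℝ a g, x ∈ v.boundary ℝ ∧
      ∀ y ∈ segment ℝ a x, y ∈ v.boundary ℝ → y = x := by
    have hK : IsCompact (segment ℝ a g ∩ v.boundary ℝ) :=
      (isCompact_segment a g).inter (isCompact_boundary v)
    obtain ⟨x, hx, hmin⟩ := hK.exists_isMinOn ⟨g, right_mem_segment _ _ _, hgb⟩
      (f := fun y => dist a y) (by fun_prop)
    refine ⟨x, hx.1, hx.2, fun y hy hyb => ?_⟩
    have h1 := isMinOn_iff.1 hmin y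
      ⟨(convex_segment a g).segment_subset (left_mem_segment _ _ _) hx.1 hy, hyb⟩
    have h2 := dist_add_dist_of_mem_segment hy
    exact dist_le_zero.1 (by linarith)
  have hxtri : x ∈ triangle :=
    convex_triangle.segment_subset hatri (hr hg.1) hxag
  by_cases hxv : x ∈ range v.vertices
  · refine ⟨x, ⟨hxv, fun hxc => ?_⟩, ?_⟩
    -- A corner on the segment ag is an extreme point, hence equals a or g; the first is off the
    -- chain and the second is not a corner.
    · rw [← extremePoints_triangle, mem_extremePoints_iff_forall_segment] at hxc
      rcases hxc.2 a hatri g (hr hg.1) hxag with h | h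
      · exact ha1 (h ▸ hxb)
      · have : g ∈ extremePoints ℝ triangle := by
          rw [mem_extremePoints_iff_forall_segment, h]
          exact hxc
        rw [extremePoints_triangle] at this
        exact hg.2 this
    · have h1 : openSegment ℝ a x ⊆ connectedComponentIn (v.boundary ℝ)ᶜ a := by
        have hsub : insert a (openSegment ℝ a x) ⊆ (v.boundary ℝ)ᶜ := by
          rintro y (rfl | hy) hyb
          · exact ha1 hyb
          · have := hfree y (openSegment_subset_segment _ _ _ hy) hyb
            rw [this, right_mem_openSegment_iff] at hy
            exact ha1 (hy ▸ hxb)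
        have hpre : IsPreconnected (insert a (openSegment ℝ a x)) :=
          (convex_openSegment a x).isPreconnected.subset_closure (subset_insert _ _)
            (by
              rw [closure_openSegment]
              exact insert_subset (left_mem_segment _ _ _) (openSegment_subset_segment _ _ _))
        exact (subset_insert _ _).trans
          (hpre.subset_connectedComponentIn (mem_insert _ _) hsub)
      have h2 := closure_subset_region hb h1
      rwa [closure_openSegment] at h2
  · obtain ⟨i, hi⟩ := (mem_boundary_iff v x).1 hxb
    obtain ⟨s, hs, hsc, hsv⟩ := exists_visible_vertex hv ha1 hb hfree hxv i rfl ⟨_, rfl⟩ ⟨_, rfl⟩ hi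
    obtain ⟨s', hs', hsc', hsv'⟩ := exists_visible_vertex hv ha1 hb hfree hxv i
      (segment_symm _ _ _) ⟨_, rfl⟩ ⟨_, rfl⟩ (segment_symm ℝ (v i) _ ▸ hi)
    by_cases hcor : s ∈ corners
    swap
    · exact ⟨s, ⟨hs, hcor⟩, hsv⟩
    by_cases hcor' : s' ∈ corners
    swap
    · exact ⟨s', ⟨hs', hcor'⟩, hsv'⟩
    exfalso
    -- A corner in the triangle axp is extreme there, so it is one of a, x, p; only p is a vertex of
    -- the polygon.
    have key : ∀ s p, p ∈ range v.vertices → s ∈ range v.vertices → s ∈ corners →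
        s ∈ convexHull ℝ {a, x, p} → s = p := by
      intro s p hp hs hcor hsc
      have hsub : convexHull ℝ {a, x, p} ⊆ triangle :=
        convexHull_min (by rintro z (rfl | rfl | rfl); exacts [hatri, hxtri, hr hp])
          convex_triangle
      rw [← extremePoints_triangle] at hcor
      rcases extremePoints_convexHull_subset
        (inter_extremePoints_subset_extremePoints_of_subset hsub ⟨hsc, hcor⟩) with h | h | h
      · obtain ⟨j, hj⟩ := hs
        exact absurd (h ▸ hj ▸ vertex_mem_boundary v j) ha1
      · exact absurd (h ▸ hs) hxv
      · exact h
    have e1 := key _ _ ⟨i, rfl⟩ hs hcor hsc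
    have e2 := key _ _ ⟨finRotate m i, rfl⟩ hs' hcor' hsc'
    rw [e1] at hcor
    rw [e2] at hcor'
    obtain ⟨f, hfp, hfq, hf0, hfs⟩ := exists_side hcor hcor' (hv.ne_next i)
    have hfx : f x ≤ 0 := nonpos_of_mem_segment hi hfp.le hfq.le
    -- The functional of the side is nonnegative on the hull and vanishes at x, which lies on ag and
    -- is not g; so it vanishes at a.
    have hfa : f a = 0 := by
      obtain ⟨s, t, hs, ht, hst, hxe, hfx'⟩ := exists_of_mem_segment hxag
      have h1 := hf0 a hatri
      have h2 := hf0 g (hr hg.1)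
      have h3 := hfx' f
      have hs0 : 0 < s := hs.lt_of_ne (by
        rintro rfl
        rw [zero_add] at hst
        simp [hst] at hxe
        exact hxv (hxe ▸ hg.1))
      have h4 := mul_nonneg ht h2
      have h5 : s * f a ≤ 0 := by linarith
      nlinarith
    exact ha1 (segment_subset_boundary v i (hfs a hatri hfa))

/-- If the convex hull is a triangle and there is an interior point, then the interior points guard
every simple polygon. -/
lemma isInteriorUniversalGuardSet_of_eq {S G : Finset Plane} (h1 : corners ⊆ S)
    (h2 : (S : Set Plane) ⊆ triangle) (hne : ((S : Set Plane) \ corners).Nonempty)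
    (hG : (G : Set Plane) = (S : Set Plane) \ corners) : IsInteriorUniversalGuardSet S G := by
  refine ⟨by rw [interiorPoints_eq h1 h2, hG], ?_⟩
  rintro P ⟨m, v, hv, hr, rfl⟩
  obtain ⟨g, hg⟩ := hne
  refine (iUnion₂_subset fun g _ a ha => ha.1).antisymm ?_
  have hclosed : IsClosed (⋃ g ∈ G, visibleRegion (region v) g) :=
    G.finite_toSet.isClosed_biUnion fun g _ => isClosed_visibleRegion (isClosed_region v) g
  refine hv.region_subset_closure_inside.trans (closure_minimal (fun a ha => ?_) hclosed)
  obtain ⟨s, hs, hsv⟩ := exists_visible_of_mem_inside hv (hr ▸ h2) (hr ▸ hg) ha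
  rw [hr, ← hG] at hs
  exact mem_iUnion₂.2 ⟨s, hs, Or.inr ha, segment_symm ℝ a s ▸ hsv⟩

/-! ### Polygons given by sequences of points -/

/-- The polygon through the first `m` points of a sequence. -/
def chain (f : ℕ → Plane) (m : ℕ) : Polygon Plane m := ⟨fun i => f i⟩

lemma chain_next {f : ℕ → Plane} {m : ℕ} (h : f m = f 0) (i : Fin m) :
    chain f m (finRotate m i) = f (i + 1) := by
  obtain ⟨k, rfl⟩ : ∃ k, m = k + 1 := ⟨m - 1, by have := i.2; omega⟩
  rw [finRotate_apply]
  change f ((i + 1 : Fin (k + 1)) : ℕ) = _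
  rw [Fin.val_add_one]
  split_ifs with hi
  · rw [hi, Fin.val_last, h]
  · rfl

lemma mem_boundary_chain {f : ℕ → Plane} {m : ℕ} (h : f m = f 0) {x : Plane} :
    x ∈ (chain f m).boundary ℝ ↔ ∃ i < m, x ∈ segment ℝ (f i) (f (i + 1)) := by
  rw [mem_boundary_iff]
  constructor
  · rintro ⟨i, hi⟩
    rw [chain_next h] at hi
    exact ⟨i, i.2, hi⟩
  · rintro ⟨i, him, hi⟩
    exact ⟨⟨i, him⟩, by rw [chain_next h]; exact hi⟩

lemma isSimple_chain {f : ℕ → Plane} {m : ℕ} (hm : 3 ≤ m) (h : f m = f 0)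
    (hinj : ∀ i j, i < j → j < m → f i ≠ f j)
    (hedge : ∀ i j, i < j → j < m → ∀ x ∈ segment ℝ (f i) (f (i + 1)),
      x ∈ segment ℝ (f j) (f (j + 1)) → (x = f i ∨ x = f (i + 1)) ∧ (x = f j ∨ x = f (j + 1))) :
    IsSimple (chain f m) := by
  refine ⟨hm, fun i j hij => ?_, fun i j hij x hx => ?_⟩
  · rcases lt_trichotomy i j with hlt | heq | hlt
    · exact absurd hij (hinj i j hlt j.2)
    · exact heq
    · exact absurd hij.symm (hinj j i hlt i.2)
  · rw [edgeSet_eq_segment, edgeSet_eq_segment, chain_next h, chain_next h] at hx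
    simp only [chain_next h, mem_inter_iff, mem_insert_iff, mem_singleton_iff]
    rcases lt_or_gt_of_ne hij with hlt | hlt
    · exact hedge i j hlt j.2 x hx.1 hx.2
    · exact (hedge j i hlt i.2 x hx.2 hx.1).symm

/-! ### Separating lines and star-shaped chains. -/

lemma false_of_separated (φ : Plane →ᵃ[ℝ] ℝ) {p q r s x : Plane} (hp : φ p ≤ 0) (hq : φ q ≤ 0)
    (hr : 0 < φ r) (hs : 0 < φ s) (h1 : x ∈ segment ℝ p q) (h2 : x ∈ segment ℝ r s) : False :=
  (pos_of_mem_segment h2 hr hs).not_ge (nonpos_of_mem_segment h1 hp hq)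

lemma eq_of_separated (φ : Plane →ᵃ[ℝ] ℝ) {p q r x : Plane} (hp : φ p ≤ 0) (hq : φ q = 0)
    (hr : 0 < φ r) (h1 : x ∈ segment ℝ p q) (h2 : x ∈ segment ℝ q r) : x = q := by
  obtain ⟨s, t, hs, ht, hst, hx, hf⟩ := exists_of_mem_segment h2
  have h3 := nonpos_of_mem_segment h1 hp hq.le
  rw [hf φ, hq, mul_zero, zero_add] at h3
  have ht0 : t = 0 := by nlinarith
  have hs1 : s = 1 := by linarith
  rw [hx, ht0, hs1, one_smul, zero_smul, add_zero]

/-- The functional that vanishes at `w` and at the common zero of `f` and `g`. -/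
noncomputable def turn (f g : Plane →ᵃ[ℝ] ℝ) (w : Plane) : Plane →ᵃ[ℝ] ℝ := g w • f - f w • g

lemma turn_apply (f g : Plane →ᵃ[ℝ] ℝ) (w z : Plane) : turn f g w z = g w * f z - f w * g z := by
  simp [turn]

lemma turn_self (f g : Plane →ᵃ[ℝ] ℝ) (w : Plane) : turn f g w w = 0 := by
  rw [turn_apply]; ring

lemma turn_comm (f g : Plane →ᵃ[ℝ] ℝ) (w z : Plane) : turn f g w z = -turn f g z w := by
  rw [turn_apply, turn_apply]; ring

/-- Barycentric coordinates with respect to a triangle. -/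
structure IsFrame (A B C : Plane) (a b c : Plane →ᵃ[ℝ] ℝ) : Prop where
  aA : a A = 1
  aB : a B = 0
  aC : a C = 0
  bA : b A = 0
  bB : b B = 1
  bC : b C = 0
  cA : c A = 0
  cB : c B = 0
  cC : c C = 1
  sum : ∀ z, a z + b z + c z = 1

/-- A closed chain `C, f 1, …, f (q + 1), A, B, f (q + 4), …, f M` in which both paths starting at
`C` turn monotonically around `C`, and the line through `A` and `f (q + 1)` separates them. -/
structure IsStarChain (A B C : Plane) (a b c : Plane →ᵃ[ℝ] ℝ) (f : ℕ → Plane) (q M : ℕ) : Prop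
    extends IsFrame A B C a b c where
  hM : q + 3 ≤ M
  f0 : f 0 = C
  fM : f (M + 1) = C
  fA : f (q + 2) = A
  fB : f (q + 3) = B
  posL : ∀ i, 1 ≤ i → i ≤ q + 1 → 0 < a (f i) ∧ 0 < b (f i) ∧ 0 < c (f i)
  posR : ∀ i, q + 4 ≤ i → i ≤ M → 0 < a (f i) ∧ 0 < b (f i) ∧ 0 < c (f i)
  monoL : ∀ i j, 1 ≤ i → i < j → j ≤ q + 1 → 0 < turn b a (f i) (f j)
  monoR : ∀ i j, q + 4 ≤ i → i < j → j ≤ M → 0 < turn b a (f i) (f j)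
  leftL : ∀ i, 1 ≤ i → i ≤ q → turn b c (f (q + 1)) (f i) < 0
  rightR : ∀ i, q + 4 ≤ i → i ≤ M → 0 < turn b c (f (q + 1)) (f i)
  belowR : ∀ i, q + 5 ≤ i → i ≤ M → 0 < turn c a (f (q + 4)) (f i)
  lastR : ∀ i, 1 ≤ i → i ≤ q + 1 → q + 4 ≤ M → 0 < turn b a (f i) (f M)

namespace IsStarChain

variable {A B C : Plane} {a b c : Plane →ᵃ[ℝ] ℝ} {f : ℕ → Plane} {q M : ℕ}

lemma closed (h : IsStarChain A B C a b c f q M) : f (M + 1) = f 0 := by rw [h.fM, h.f0]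

lemma turn_A (h : IsStarChain A B C a b c f q M) : turn b c (f (q + 1)) A = 0 := by
  rw [turn_apply, h.bA, h.cA]; ring

lemma turn_B (h : IsStarChain A B C a b c f q M) : 0 < turn b c (f (q + 1)) B := by
  rw [turn_apply, h.bB, h.cB]
  linarith [(h.posL (q + 1) (by omega) le_rfl).2.2]

lemma left (h : IsStarChain A B C a b c f q M) {i : ℕ} (hi : i ≤ q) :
    turn b c (f (q + 1)) (f i) < 0 := by
  rcases Nat.eq_zero_or_pos i with rfl | hi0
  · rw [h.f0, turn_apply, h.bC, h.cC]
    linarith [(h.posL (q + 1) (by omega) le_rfl).2.1]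
  · exact h.leftL i hi0 hi

lemma left' (h : IsStarChain A B C a b c f q M) {i : ℕ} (hi : i ≤ q + 1) :
    turn b c (f (q + 1)) (f i) ≤ 0 := by
  rcases hi.lt_or_eq with hi | rfl
  · exact (h.left (by omega)).le
  · rw [turn_self]

lemma turn_C (h : IsStarChain A B C a b c f q M) (w : Plane) : turn b a w C = 0 := by
  rw [turn_apply, h.bC, h.aC]; ring

lemma cposL (h : IsStarChain A B C a b c f q M) {i : ℕ} (hi : i ≤ q + 1) : 0 < c (f i) := by
  rcases Nat.eq_zero_or_pos i with rfl | hi0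
  · rw [h.f0, h.cC]; exact one_pos
  · exact (h.posL i hi0 hi).2.2

lemma cposR (h : IsStarChain A B C a b c f q M) {i : ℕ} (h1 : q + 4 ≤ i) (h2 : i ≤ M + 1) :
    0 < c (f i) := by
  rcases h2.lt_or_eq with h2 | rfl
  · exact (h.posR i h1 (by omega)).2.2
  · rw [h.fM, h.cC]; exact one_pos

lemma belowR' (h : IsStarChain A B C a b c f q M) {i : ℕ} (h0 : q + 4 ≤ M) (h1 : q + 5 ≤ i)
    (h2 : i ≤ M + 1) : 0 < turn c a (f (q + 4)) (f i) := by
  rcases h2.lt_or_eq with h2 | rfl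
  · exact h.belowR i h1 (by omega)
  · rw [h.fM, turn_apply, h.cC, h.aC]
    linarith [(h.posR (q + 4) le_rfl h0).1]

lemma injective (h : IsStarChain A B C a b c f q M) (i j : ℕ) (hij : i < j) (hj : j < M + 1) :
    f i ≠ f j := by
  intro heq
  have hM := h.hM
  by_cases hiL : i ≤ q + 1
  · rcases (by omega : j ≤ q + 1 ∨ j = q + 2 ∨ j = q + 3 ∨ q + 4 ≤ j) with hj' | rfl | rfl | hj'
    · rcases Nat.eq_zero_or_pos i with rfl | hi0
      · have := (h.posL j (by omega) hj').2.1
        rw [← heq, h.f0, h.bC] at this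
        exact this.false
      · have := h.monoL i j hi0 hij hj'
        rw [heq, turn_self] at this
        exact this.false
    · have := h.cposL hiL
      rw [heq, h.fA, h.cA] at this
      exact this.false
    · have := h.cposL hiL
      rw [heq, h.fB, h.cB] at this
      exact this.false
    · have := h.left' hiL
      rw [heq] at this
      exact this.not_gt (h.rightR j hj' (by omega))
  · rcases (by omega : i = q + 2 ∨ i = q + 3 ∨ q + 4 ≤ i) with rfl | rfl | hi
    · rcases (by omega : j = q + 3 ∨ q + 4 ≤ j) with rfl | hj'
      · have := h.aA
        rw [← h.fA, heq, h.fB, h.aB] at this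
        exact zero_ne_one this
      · have := h.cposR hj' (by omega)
        rw [← heq, h.fA, h.cA] at this
        exact this.false
    · have := h.cposR (i := j) (by omega) (by omega)
      rw [← heq, h.fB, h.cB] at this
      exact this.false
    · have := h.monoR i j hi hij (by omega)
      rw [heq, turn_self] at this
      exact this.false

/-- Each pair of edges is separated by a line. Edges within one path: a line through C and a vertex.
The left path with its edge to A, against right edges not ending at C: the line through A and `f (q
+ 1)`. The edge AB: the side c = 0. The edge from B to the right path, against later edges: its own
line. The closing edge at C: its own line, which is BC when the right path is empty. -/
lemma edges (h : IsStarChain A B C a b c f q M) (i j : ℕ) (hij : i < j) (hj : j < M + 1)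
    (x : Plane) (hx : x ∈ segment ℝ (f i) (f (i + 1))) (hx' : x ∈ segment ℝ (f j) (f (j + 1))) :
    (j = i + 1 ∧ x = f j) ∨ (i = 0 ∧ j = M ∧ x = f 0) := by
  have hM := h.hM
  have hneg : ∀ {φ : Plane →ᵃ[ℝ] ℝ} {z : Plane}, φ z < 0 → 0 < (-φ) z := fun h => by
    simpa using h
  have hneg' : ∀ {φ : Plane →ᵃ[ℝ] ℝ} {z : Plane}, φ z = 0 → (-φ) z = 0 := fun h => by
    simpa using h
  have hlastL : ∀ k, 1 ≤ k → k ≤ q + 1 → q + 4 ≤ M → turn b a (f M) (f k) < 0 := by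
    intro k h1 h2 h3
    rw [turn_comm]
    exact neg_neg_of_pos (h.lastR k h1 h2 h3)
  by_cases hiL : i ≤ q
  · rcases (by omega : j ≤ q ∨ j = q + 1 ∨ j = q + 2 ∨ (j = q + 3 ∧ q + 3 < M) ∨
      (j = q + 3 ∧ M = q + 3) ∨ (q + 4 ≤ j ∧ j < M) ∨ (q + 4 ≤ j ∧ j = M)) with
      hj' | rfl | rfl | ⟨rfl, hlt⟩ | ⟨rfl, hMq⟩ | ⟨hj', hlt⟩ | ⟨hj', rfl⟩
    · have h1 : turn b a (f (i + 1)) (f i) ≤ 0 := by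
        rcases Nat.eq_zero_or_pos i with rfl | hi0
        · rw [h.f0, h.turn_C]
        · rw [turn_comm]
          linarith [h.monoL i (i + 1) hi0 (by omega) (by omega)]
      have h2 : turn b a (f (i + 1)) (f (i + 1)) = 0 := turn_self _ _ _
      have h3 := h.monoL (i + 1) (j + 1) (by omega) (by omega) (by omega)
      rcases (by omega : j = i + 1 ∨ i + 1 < j) with rfl | hlt
      · exact Or.inl ⟨rfl, eq_of_separated _ h1 h2 h3 hx hx'⟩
      · exact (false_of_separated _ h1 h2.le (h.monoL (i + 1) j (by omega) hlt (by omega)) h3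
          hx hx').elim
    · rw [h.fA] at hx'
      have hh : turn b c (f (q + 1)) (f (q + 1)) = 0 := turn_self _ _ _
      rcases hiL.lt_or_eq with hlt | rfl
      · exact (false_of_separated (-turn b c (f (q + 1))) (hneg' hh).le (hneg' h.turn_A).le
          (hneg (h.left hiL)) (hneg (h.left (by omega))) hx' hx).elim
      · rw [segment_symm] at hx hx'
        exact Or.inl ⟨rfl, eq_of_separated (-turn b c (f (i + 1))) (hneg' h.turn_A).le (hneg' hh)
          (hneg (h.left le_rfl)) hx' hx⟩
    · rw [h.fA, h.fB] at hx'
      exact (false_of_separated c h.cA.le h.cB.le (h.cposL (by omega)) (h.cposL (by omega))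
        hx' hx).elim
    · rw [h.fB] at hx'
      exact (false_of_separated _ (h.left' (by omega)) (h.left' (by omega)) h.turn_B
        (h.rightR _ le_rfl (by omega)) hx hx').elim
    · have hc := h.fM
      rw [hMq] at hc
      rw [h.fB, hc] at hx'
      rcases Nat.eq_zero_or_pos i with rfl | hi0
      · rw [h.f0] at hx ⊢
        exact Or.inr ⟨rfl, hMq.symm, eq_of_separated a h.aB.le h.aC
          (h.posL 1 le_rfl (by omega)).1 hx' hx⟩
      · exact (false_of_separated a h.aB.le h.aC.le (h.posL i hi0 (by omega)).1
          (h.posL _ (by omega) (by omega)).1 hx' hx).elim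
    · exact (false_of_separated _ (h.left' (by omega)) (h.left' (by omega)) (h.rightR _ hj' hlt.le)
        (h.rightR _ (by omega) (by omega)) hx hx').elim
    · rw [h.fM] at hx'
      have e1 : (-turn b a (f j)) (f j) = 0 := hneg' (turn_self _ _ _)
      have e2 : (-turn b a (f j)) C = 0 := hneg' (h.turn_C _)
      rcases Nat.eq_zero_or_pos i with rfl | hi0
      · rw [h.f0] at hx ⊢
        exact Or.inr ⟨rfl, rfl, eq_of_separated (-turn b a (f j)) e1.le e2
          (hneg (hlastL 1 le_rfl (by omega) hj')) hx' hx⟩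
      · exact (false_of_separated (-turn b a (f j)) e1.le e2.le
          (hneg (hlastL i hi0 (by omega) hj')) (hneg (hlastL _ (by omega) (by omega) hj'))
          hx' hx).elim
  rcases (by omega : i = q + 1 ∨ i = q + 2 ∨ i = q + 3 ∨ q + 4 ≤ i) with rfl | rfl | rfl | hiR
  · rw [h.fA] at hx
    have hh : turn b c (f (q + 1)) (f (q + 1)) = 0 := turn_self _ _ _
    rcases (by omega : j = q + 2 ∨ (j = q + 3 ∧ q + 3 < M) ∨
      (j = q + 3 ∧ M = q + 3) ∨ (q + 4 ≤ j ∧ j < M) ∨ (q + 4 ≤ j ∧ j = M)) with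
      rfl | ⟨rfl, hlt⟩ | ⟨rfl, hMq⟩ | ⟨hj', hlt⟩ | ⟨hj', rfl⟩
    · rw [h.fA, h.fB, segment_symm] at hx'
      rw [segment_symm] at hx
      rw [h.fA]
      exact Or.inl ⟨rfl, eq_of_separated c h.cB.le h.cA (h.cposL le_rfl) hx' hx⟩
    · rw [h.fB] at hx'
      exact (false_of_separated _ hh.le h.turn_A.le h.turn_B (h.rightR _ le_rfl (by omega))
        hx hx').elim
    · have hc := h.fM
      rw [hMq] at hc
      rw [h.fB, hc] at hx'
      exact (false_of_separated a h.aB.le h.aC.le (h.posL _ (by omega) le_rfl).1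
        (by rw [h.aA]; exact one_pos) hx' hx).elim
    · exact (false_of_separated _ hh.le h.turn_A.le (h.rightR _ hj' hlt.le)
        (h.rightR _ (by omega) (by omega)) hx hx').elim
    · rw [h.fM] at hx'
      refine (false_of_separated (-turn b a (f j)) (hneg' (turn_self _ _ _)).le
        (hneg' (h.turn_C _)).le (hneg (hlastL _ (by omega) le_rfl hj')) (hneg ?_) hx' hx).elim
      rw [turn_apply, h.bA, h.aA]
      linarith [(h.posR j hj' le_rfl).2.1]
  · rw [h.fA, h.fB] at hx
    rcases (by omega : j = q + 3 ∨ q + 4 ≤ j) with rfl | hj'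
    · rw [h.fB] at hx' ⊢
      exact Or.inl ⟨rfl, eq_of_separated c h.cA.le h.cB (h.cposR le_rfl (by omega)) hx hx'⟩
    · exact (false_of_separated c h.cA.le h.cB.le (h.cposR hj' (by omega))
        (h.cposR (by omega) (by omega)) hx hx').elim
  · rw [h.fB] at hx
    have e1 : turn c a (f (q + 4)) B ≤ 0 := by rw [turn_apply, h.cB, h.aB]; linarith
    have e2 : turn c a (f (q + 4)) (f (q + 4)) = 0 := turn_self _ _ _
    rcases (by omega : j = q + 4 ∨ q + 5 ≤ j) with rfl | hj'
    · exact Or.inl ⟨rfl, eq_of_separated _ e1 e2 (h.belowR' (by omega) (by omega) (by omega)) hx hx'⟩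
    · exact (false_of_separated _ e1 e2.le (h.belowR' (by omega) hj' (by omega))
        (h.belowR' (by omega) (by omega) (by omega)) hx hx').elim
  · rcases (by omega : j < M ∨ j = M) with hlt | rfl
    · have h1 : turn b a (f (i + 1)) (f i) ≤ 0 := by
        rw [turn_comm]
        linarith [h.monoR i (i + 1) hiR (by omega) (by omega)]
      have h2 : turn b a (f (i + 1)) (f (i + 1)) = 0 := turn_self _ _ _
      have h3 := h.monoR (i + 1) (j + 1) (by omega) (by omega) (by omega)
      rcases (by omega : j = i + 1 ∨ i + 1 < j) with rfl | hlt'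
      · exact Or.inl ⟨rfl, eq_of_separated _ h1 h2 h3 hx hx'⟩
      · exact (false_of_separated _ h1 h2.le (h.monoR (i + 1) j (by omega) hlt' (by omega)) h3
          hx hx').elim
    · rw [h.fM] at hx'
      have e1 : (-turn b a (f j)) (f j) = 0 := hneg' (turn_self _ _ _)
      have e2 : (-turn b a (f j)) C = 0 := hneg' (h.turn_C _)
      have e3 : ∀ k, q + 4 ≤ k → k < j → 0 < (-turn b a (f j)) (f k) := by
        intro k hk hkj
        apply hneg
        rw [turn_comm]
        exact neg_neg_of_pos (h.monoR k j hk hkj le_rfl)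
      rcases (by omega : j = i + 1 ∨ i + 1 < j) with rfl | hlt'
      · rw [segment_symm] at hx hx'
        exact Or.inl ⟨rfl, eq_of_separated _ e2.le e1 (e3 i hiR (by omega)) hx' hx⟩
      · exact (false_of_separated _ e1.le e2.le (e3 i hiR hij) (e3 _ (by omega) hlt') hx' hx).elim

lemma isSimple (h : IsStarChain A B C a b c f q M) : IsSimple (chain f (M + 1)) := by
  have hM := h.hM
  refine isSimple_chain (by omega) h.closed h.injective fun i j hij hj x hx hx' => ?_
  rcases h.edges i j hij hj x hx hx' with ⟨rfl, rfl⟩ | ⟨rfl, rfl, rfl⟩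
  · exact ⟨Or.inr rfl, Or.inl rfl⟩
  · exact ⟨Or.inl rfl, Or.inr h.closed.symm⟩

end IsStarChain

/-! ### Hidden points -/

lemma eventually_lt_combo {α x : ℝ} (y : ℝ) (h : α < x) :
    ∀ᶠ δ in 𝓝[>] (0 : ℝ), α < (1 - δ) * x + δ * y := by
  have hc : Continuous fun δ : ℝ => (1 - δ) * x + δ * y := by fun_prop
  have h0 := hc.tendsto 0
  simp only [sub_zero, one_mul, zero_mul, add_zero] at h0
  exact nhdsWithin_le_nhds (h0.eventually (lt_mem_nhds h))

lemma eventually_mem_Ioo : ∀ᶠ δ in 𝓝[>] (0 : ℝ), 0 < δ ∧ δ < 1 :=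
  Ioo_mem_nhdsGT one_pos

lemma combo_apply (f : Plane →ᵃ[ℝ] ℝ) (δ : ℝ) (x y : Plane) :
    f ((1 - δ) • x + δ • y) = (1 - δ) * f x + δ * f y := by
  rw [Convex.combo_affine_apply (by ring), smul_eq_mul, smul_eq_mul]

lemma combo_mem_segment {δ : ℝ} (h : 0 < δ ∧ δ < 1) (x y : Plane) :
    (1 - δ) • x + δ • y ∈ segment ℝ x y :=
  ⟨1 - δ, δ, by linarith [h.2], h.1.le, by ring, rfl⟩

/-- Near a vertex of the convex hull, the points off the angle of the polygon are outside. -/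
lemma exists_corner {f : ℕ → Plane} {m k : ℕ} (hper : f m = f 0) (hk : k + 1 < m)
    (l a : Plane →ᵃ[ℝ] ℝ) {P Q : Plane} (hPQ : P ≠ Q) (hl : l Q ≤ l P) (ha : a Q ≤ a P)
    (h1 : l (f k) ≤ 0) (h2 : l (f (k + 1)) = 0) (h3 : l (f (k + 2)) ≤ 0)
    (hlt : ∀ i ≤ m, i ≠ k + 1 → a (f i) < 1) :
    ∃ α < 1, Disjoint {z | 0 < l z ∧ α < a z} ((chain f m).boundary ℝ) ∧
      ∀ z, 0 < l z → α < a z → ¬ IsBounded {z | 0 < l z ∧ α < a z} := by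
  -- The threshold α is the largest value of a at the other vertices; above it only the two edges at
  -- the corner can occur, and these satisfy l ≤ 0.
  obtain ⟨j, hj, hmax⟩ := ((Finset.range (m + 1)).erase (k + 1)).exists_max_image
    (fun i => a (f i)) ⟨0, by simp⟩
  simp only [Finset.mem_erase, Finset.mem_range, ne_eq] at hj hmax
  refine ⟨a (f j), hlt j (by omega) hj.1, ?_, fun z hz1 hz2 => ?_⟩
  · rw [disjoint_left]
    rintro z ⟨hz1, hz2⟩ hzb
    obtain ⟨i, him, hi⟩ := (mem_boundary_chain hper).1 hzb
    rcases eq_or_ne i k with rfl | hik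
    · exact (nonpos_of_mem_segment hi h1 h2.le).not_gt hz1
    rcases eq_or_ne i (k + 1) with rfl | hik'
    · exact (nonpos_of_mem_segment hi h2.le h3).not_gt hz1
    obtain ⟨s, t, hs, ht, hst, -, hf⟩ := exists_of_mem_segment hi
    have e1 := hmax i ⟨hik', by omega⟩
    have e2 := hmax (i + 1) ⟨by omega, by omega⟩
    have e3 := mul_le_mul_of_nonneg_left e1 hs
    have e4 := mul_le_mul_of_nonneg_left e2 ht
    have e5 : s * a (f j) + t * a (f j) = a (f j) := by rw [← add_mul, hst, one_mul]
    rw [hf] at hz2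
    linarith
  -- Neither functional decreases in the direction P - Q, so the set contains a ray.
  · refine not_isBounded_of_ray (x := z) (d := P - Q) (sub_ne_zero.2 hPQ) fun t ht => ?_
    have key : ∀ g : Plane →ᵃ[ℝ] ℝ, g (z + t • (P - Q)) = g z + t * (g P - g Q) := by
      intro g
      have e1 := g.map_vadd z (t • (P - Q))
      rw [vadd_eq_add, vadd_eq_add, map_smul, smul_eq_mul] at e1
      have e2 := g.linearMap_vsub P Q
      rw [vsub_eq_sub, vsub_eq_sub] at e2
      rw [add_comm z, e1, e2, add_comm]
    constructor
    · rw [key]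
      have := mul_nonneg ht (sub_nonneg.2 hl)
      linarith
    · rw [key]
      have := mul_nonneg ht (sub_nonneg.2 ha)
      linarith

lemma convex_corner (l a : Plane →ᵃ[ℝ] ℝ) (α : ℝ) : Convex ℝ {z | 0 < l z ∧ α < a z} :=
  ((convex_Ioi 0).affine_preimage l).inter ((convex_Ioi α).affine_preimage a)

/-- A hull vertex does not see the points off its angle. -/
lemma not_segment_subset_of_corner {f : ℕ → Plane} {m k : ℕ} (hper : f m = f 0) (hk : k + 1 < m)
    (l a : Plane →ᵃ[ℝ] ℝ) {P Q : Plane} (hPQ : P ≠ Q) (hl : l Q ≤ l P) (ha : a Q ≤ a P)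
    (h1 : l (f k) ≤ 0) (h2 : l (f (k + 1)) = 0) (h3 : l (f (k + 2)) ≤ 0)
    (h4 : a (f (k + 1)) = 1) (hlt : ∀ i ≤ m, i ≠ k + 1 → a (f i) < 1) {s : Plane} (hs : 0 < l s) :
    ¬ segment ℝ s (f (k + 1)) ⊆ region (chain f m) := by
  intro hsub
  obtain ⟨α, hα, hd, hu⟩ := exists_corner hper hk l a hPQ hl ha h1 h2 h3 hlt
  obtain ⟨δ, hδ1, hδ⟩ := ((eventually_lt_combo (a s) (h4.symm ▸ hα)).and eventually_mem_Ioo).exists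
  rw [← combo_apply] at hδ1
  have hl' : 0 < l ((1 - δ) • f (k + 1) + δ • s) := by
    rw [combo_apply, h2, mul_zero, zero_add]
    exact mul_pos hδ.1 hs
  refine notMem_region_of_not_isBounded (convex_corner l a α).isPreconnected hd ⟨hl', hδ1⟩
    (hu _ hl' hδ1) (hsub ?_)
  rw [segment_symm]
  exact combo_mem_segment hδ _ _

namespace IsStarChain

variable {A B C : Plane} {a b c : Plane →ᵃ[ℝ] ℝ} {f : ℕ → Plane} {q M : ℕ}

lemma A_ne_B (h : IsStarChain A B C a b c f q M) : A ≠ B := fun e => by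
  have := h.aA
  rw [e, h.aB] at this
  exact zero_ne_one this

lemma lt_one (h : IsStarChain A B C a b c f q M) (i : ℕ) (hi : i ≤ M + 1) :
    (i ≠ q + 2 → a (f i) < 1) ∧ (i ≠ q + 3 → b (f i) < 1) := by
  have hpos : (0 < a (f i) ∧ 0 < b (f i) ∧ 0 < c (f i)) →
      (i ≠ q + 2 → a (f i) < 1) ∧ (i ≠ q + 3 → b (f i) < 1) := by
    rintro ⟨h1, h2, h3⟩
    have := h.sum (f i)
    exact ⟨fun _ => by linarith, fun _ => by linarith⟩
  have hC : f i = C → (i ≠ q + 2 → a (f i) < 1) ∧ (i ≠ q + 3 → b (f i) < 1) := by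
    intro e
    rw [e, h.aC, h.bC]
    simp
  rcases (by omega : i = 0 ∨ (1 ≤ i ∧ i ≤ q + 1) ∨ i = q + 2 ∨ i = q + 3 ∨ (q + 4 ≤ i ∧ i ≤ M) ∨
    i = M + 1) with rfl | ⟨h1, h2⟩ | rfl | rfl | ⟨h1, h2⟩ | rfl
  · exact hC h.f0
  · exact hpos (h.posL i h1 h2)
  · rw [h.fA, h.bA]; simp
  · rw [h.fB, h.aB]; simp
  · exact hpos (h.posR i h1 h2)
  · exact hC h.fM

/-- The points beyond the line through `A` and `f (q + 1)` are not visible from `A`. -/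
lemma not_visible_A (h : IsStarChain A B C a b c f q M) {s : Plane}
    (hs : turn b c (f (q + 1)) s < 0) : ¬ segment ℝ s A ⊆ region (chain f (M + 1)) := by
  have hM := h.hM
  rw [← h.fA]
  have hB := h.turn_B
  refine not_segment_subset_of_corner h.closed (by omega) (-turn b c (f (q + 1))) a h.A_ne_B
    ?_ ?_ ?_ ?_ ?_ ?_ (fun i hi => (h.lt_one i hi).1) ?_
  · simpa [h.turn_A] using hB.le
  · rw [h.aA, h.aB]; exact zero_le_one
  · simp [turn_self]
  · simp [h.fA, h.turn_A]
  · simpa [h.fB] using hB.le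
  · rw [h.fA, h.aA]
  · simpa using hs

lemma turn_gB (h : IsStarChain A B C a b c f q M) (g : Plane) : turn c a g B = 0 := by
  rw [turn_apply, h.cB, h.aB]; ring

lemma turn_gA (h : IsStarChain A B C a b c f q M) (hM : q + 4 ≤ M) :
    turn c a (f (q + 4)) A < 0 := by
  rw [turn_apply, h.cA, h.aA]
  linarith [(h.posR (q + 4) le_rfl hM).2.2]

/-- The points below the line through `B` and `f (q + 4)` are not visible from `B`. -/
lemma not_visible_B_of_below (h : IsStarChain A B C a b c f q M) (hM : q + 4 ≤ M) {s : Plane}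
    (hs : 0 < turn c a (f (q + 4)) s) : ¬ segment ℝ s B ⊆ region (chain f (M + 1)) := by
  rw [← h.fB]
  refine not_segment_subset_of_corner h.closed (by omega) (turn c a (f (q + 4))) b h.A_ne_B.symm
    ?_ ?_ ?_ ?_ ?_ ?_ (fun i hi => (h.lt_one i hi).2) hs
  · rw [h.turn_gB]; exact (h.turn_gA hM).le
  · rw [h.bA, h.bB]; exact zero_le_one
  · rw [h.fA]; exact (h.turn_gA hM).le
  · rw [h.fB, h.turn_gB]
  · rw [turn_self]
  · rw [h.fB, h.bB]

/-- The points above the line through `B` and `f (q + 4)` and beyond the line through `A` and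
`f (q + 1)` are not visible from `B`. -/
lemma not_visible_B_of_above (h : IsStarChain A B C a b c f q M) (hM : q + 4 ≤ M)
    (hq : 0 ≤ turn c a (f (q + 4)) (f q)) {s : Plane} (hsc : 0 < c s)
    (hs : turn c a (f (q + 4)) s < 0) (hs' : turn b c (f (q + 1)) s < 0)
    (hh : 0 ≤ turn c a (f (q + 4)) (f (q + 1))) :
    ¬ segment ℝ s B ⊆ region (chain f (M + 1)) := by
  intro hsub
  set H := turn b c (f (q + 1)) with hH
  set G := turn c a (f (q + 4)) with hG
  -- Among `f 0`, …, `f q`, the vertex closest to the edge from `f (q + 1)` to A in the angular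
  -- order around A.
  obtain ⟨j, hj, hmax⟩ := (Finset.range (q + 1)).exists_max_image
    (fun i => b (f i) / c (f i)) ⟨0, by simp⟩
  simp only [Finset.mem_range] at hj hmax
  set K := turn b c (f j) with hK
  have hjc := h.cposL (i := j) (by omega)
  have hKL : ∀ i ≤ q, K (f i) ≤ 0 := by
    intro i hi
    have h1 := hmax i (by omega)
    rw [div_le_div_iff₀ (h.cposL (by omega)) hjc] at h1
    rw [hK, turn_apply]
    linarith
  have hKA : K A = 0 := by rw [hK, turn_apply, h.bA, h.cA]; ring
  have hHB : 0 < H B := h.turn_B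
  have hHA : H A = 0 := h.turn_A
  have hjH : H (f j) < 0 := h.left (by omega)
  -- The pocket: between the lines from A through `f (q + 1)` and through `f j`, and above the line
  -- from B through `f (q + 4)`. Every edge violates one of the three inequalities.
  set W : Set Plane := {z | H z < 0 ∧ 0 < K z ∧ G z < 0} with hW
  have hWconv : Convex ℝ W := ((convex_Iio 0).affine_preimage H).inter
    (((convex_Ioi 0).affine_preimage K).inter ((convex_Iio 0).affine_preimage G))
  have hWdisj : Disjoint W ((chain f (M + 1)).boundary ℝ) := by
    rw [disjoint_left]
    rintro z ⟨hz1, hz2, hz3⟩ hzb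
    obtain ⟨i, him, hi⟩ := (mem_boundary_chain h.closed).1 hzb
    rcases (by omega : i < q ∨ i = q ∨ i = q + 1 ∨ i = q + 2 ∨ i = q + 3 ∨ (q + 4 ≤ i ∧ i < M) ∨
      i = M) with hi' | rfl | rfl | rfl | rfl | ⟨hi', hlt⟩ | rfl
    · exact (nonpos_of_mem_segment hi (hKL i hi'.le) (hKL (i + 1) hi')).not_gt hz2
    · exact (nonneg_of_mem_segment hi hq hh).not_gt hz3
    · rw [h.fA] at hi
      exact (nonneg_of_mem_segment hi (turn_self _ _ _).ge hHA.ge).not_gt hz1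
    · rw [h.fA, h.fB] at hi
      exact (nonneg_of_mem_segment hi hHA.ge hHB.le).not_gt hz1
    · rw [h.fB] at hi
      exact (nonneg_of_mem_segment hi hHB.le (h.rightR _ le_rfl hM).le).not_gt hz1
    · exact (nonneg_of_mem_segment hi (h.rightR _ hi' hlt.le).le
        (h.rightR _ (by omega) (by omega)).le).not_gt hz1
    · refine (nonneg_of_mem_segment hi ?_ (h.belowR' hM (by omega) le_rfl).le).not_gt hz3
      rcases hM.lt_or_eq with hlt | heq
      · exact (h.belowR _ (by omega) le_rfl).le
      · rw [← heq]; exact (turn_self _ _ _).ge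
  -- Just before the line of sight from s to B crosses the line through A and `f (q + 1)`, it is in
  -- the pocket.
  obtain ⟨z, hzseg, hzW⟩ : ∃ z ∈ segment ℝ s B, z ∈ W := by
    obtain ⟨δ, hδ0, hδ1, hδ⟩ : ∃ δ : ℝ, 0 < δ ∧ δ < 1 ∧ (1 - δ) * H s + δ * H B = 0 := by
      have hpos : 0 < H B - H s := by linarith
      refine ⟨-H s / (H B - H s), div_pos (by linarith) hpos, (div_lt_one hpos).2 (by linarith), ?_⟩
      field_simp
      ring
    set y := (1 - δ) • s + δ • B with hy
    have hyH : H y = 0 := by rw [hy, combo_apply, hδ]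
    have hyc : 0 < c y := by
      rw [hy, combo_apply, h.cB, mul_zero, add_zero]
      exact mul_pos (by linarith) hsc
    have hyG : G y < 0 := by
      rw [hy, combo_apply, hG, h.turn_gB, mul_zero, add_zero, ← hG]
      exact mul_neg_of_pos_of_neg (by linarith) hs
    have hyK : 0 < K y := by
      rw [hH, turn_apply] at hyH hjH
      rw [hK, turn_apply]
      have hhc := h.cposL (i := q + 1) le_rfl
      have e1 : c (f (q + 1)) * (c (f j) * b y - b (f j) * c y) =
          c y * -(c (f (q + 1)) * b (f j) - b (f (q + 1)) * c (f j)) := by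
        linear_combination c (f j) * hyH
      have e2 := mul_pos hyc (neg_pos.2 hjH)
      rw [← e1] at e2
      exact (mul_pos_iff_of_pos_left hhc).1 e2
    obtain ⟨η, hη1, hη2, hη⟩ := ((eventually_lt_combo (K s) hyK).and
      ((eventually_lt_combo (-G s) (neg_pos.2 hyG)).and eventually_mem_Ioo)).exists
    refine ⟨(1 - η) • y + η • s, ?_, ?_, ?_, ?_⟩
    · refine (convex_segment s B).segment_subset (combo_mem_segment ⟨hδ0, hδ1⟩ s B)
        (left_mem_segment _ _ _) (combo_mem_segment hη y s)
    · rw [combo_apply, hyH, mul_zero, zero_add]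
      exact mul_neg_of_pos_of_neg hη.1 hs'
    · rw [combo_apply]; exact hη1
    · rw [combo_apply]; linarith
  obtain ⟨α, hα, hd, hu⟩ := exists_corner (k := q + 1) h.closed (by omega) (-H) a h.A_ne_B
    (by simpa [hHA] using hHB.le) (by rw [h.aA, h.aB]; exact zero_le_one)
    (by simp [hH, turn_self]) (by simp [h.fA, hHA]) (by simpa [h.fB] using hHB.le)
    (fun i hi => (h.lt_one i hi).1)
  -- The pocket reaches A, where it meets the unbounded set off the angle of the polygon; so the
  -- pocket is outside.
  obtain ⟨δ, hδ1, hδ⟩ := ((eventually_lt_combo (a z) (h.aA.symm ▸ hα)).and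
    eventually_mem_Ioo).exists
  set y := (1 - δ) • A + δ • z with hy
  have hyH : H y < 0 := by
    rw [hy, combo_apply, hHA, mul_zero, zero_add]
    exact mul_neg_of_pos_of_neg hδ.1 hzW.1
  have hyW : y ∈ W := by
    refine ⟨hyH, ?_, ?_⟩
    · rw [hy, combo_apply, hKA, mul_zero, zero_add]
      exact mul_pos hδ.1 hzW.2.1
    · rw [hy, combo_apply]
      have e1 := mul_neg_of_pos_of_neg (sub_pos.2 hδ.2) (h.turn_gA hM)
      have e2 := mul_neg_of_pos_of_neg hδ.1 hzW.2.2
      linarith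
  have hyT : y ∈ {z | 0 < (-H) z ∧ α < a z} := ⟨by simpa using hyH, by rw [hy, combo_apply]; exact hδ1⟩
  refine notMem_region_of_not_isBounded (T := W ∪ {z | 0 < (-H) z ∧ α < a z})
    (hWconv.isPreconnected.union y hyW hyT (convex_corner _ _ _).isPreconnected)
    (hWdisj.union_left hd) (Or.inl hzW) (fun hb => hu y hyT.1 hyT.2 (hb.subset subset_union_right))
    (hsub hzseg)

end IsStarChain

/-! ### Chains through a rearranged sequence -/

/-- The closed chain `C, s (t 1), …, s (t (q + 1)), A, B, s (t (q + 4)), …, s (t (N + 2)), C`. -/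
noncomputable def starSeq (A B C : Plane) (s : ℕ → Plane) (t : ℕ → ℕ) (q N : ℕ) (i : ℕ) : Plane :=
  if i = 0 ∨ N + 2 < i then C else if i = q + 2 then A else if i = q + 3 then B else s (t i)

section starSeq

variable {A B C : Plane} {a b c : Plane →ᵃ[ℝ] ℝ} {s : ℕ → Plane} {t : ℕ → ℕ} {q N : ℕ}

lemma starSeq_of {i : ℕ} (h1 : 1 ≤ i) (h2 : i ≤ N + 2) (h3 : i ≠ q + 2) (h4 : i ≠ q + 3) :
    starSeq A B C s t q N i = s (t i) := by
  rw [starSeq, if_neg (by omega), if_neg h3, if_neg h4]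

lemma isStarChain_starSeq (hfr : IsFrame A B C a b c) (hN : q + 1 ≤ N)
    (hpos : ∀ i < N, 0 < a (s i) ∧ 0 < b (s i) ∧ 0 < c (s i))
    (hmono : ∀ i j, i < j → j < N → 0 < turn b a (s i) (s j))
    (htL : ∀ i, 1 ≤ i → i ≤ q + 1 → t i < N) (htR : ∀ i, q + 4 ≤ i → i ≤ N + 2 → t i < N)
    (htmL : ∀ i j, 1 ≤ i → i < j → j ≤ q + 1 → t i < t j)
    (htmR : ∀ i j, q + 4 ≤ i → i < j → j ≤ N + 2 → t i < t j)
    (hleft : ∀ i, 1 ≤ i → i ≤ q → turn b c (s (t (q + 1))) (s (t i)) < 0)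
    (hright : ∀ i, q + 4 ≤ i → i ≤ N + 2 → 0 < turn b c (s (t (q + 1))) (s (t i)))
    (hbelow : ∀ i, q + 5 ≤ i → i ≤ N + 2 → 0 < turn c a (s (t (q + 4))) (s (t i)))
    (hlast : ∀ i, 1 ≤ i → i ≤ q + 1 → q + 4 ≤ N + 2 → t i < t (N + 2)) :
    IsStarChain A B C a b c (starSeq A B C s t q N) q (N + 2) where
  toIsFrame := hfr
  hM := by omega
  f0 := by simp [starSeq]
  fM := by simp [starSeq]
  fA := by rw [starSeq, if_neg (by omega), if_pos rfl]
  fB := by rw [starSeq, if_neg (by omega), if_neg (by omega), if_pos rfl]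
  posL i h1 h2 := by
    rw [starSeq_of h1 (by omega) (by omega) (by omega)]
    exact hpos _ (htL i h1 h2)
  posR i h1 h2 := by
    rw [starSeq_of (by omega) (by omega) (by omega) (by omega)]
    exact hpos _ (htR i h1 h2)
  monoL i j h1 h2 h3 := by
    rw [starSeq_of h1 (by omega) (by omega) (by omega),
      starSeq_of (by omega) (by omega) (by omega) (by omega)]
    exact hmono _ _ (htmL i j h1 h2 h3) (htL j (by omega) h3)
  monoR i j h1 h2 h3 := by
    rw [starSeq_of (by omega) (by omega) (by omega) (by omega),
      starSeq_of (by omega) (by omega) (by omega) (by omega)]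
    exact hmono _ _ (htmR i j h1 h2 h3) (htR j (by omega) h3)
  leftL i h1 h2 := by
    rw [starSeq_of (by omega) (by omega) (by omega) (by omega),
      starSeq_of (by omega) (by omega) (by omega) (by omega)]
    exact hleft i h1 h2
  rightR i h1 h2 := by
    rw [starSeq_of (by omega) (by omega) (by omega) (by omega),
      starSeq_of (by omega) (by omega) (by omega) (by omega)]
    exact hright i h1 h2
  belowR i h1 h2 := by
    rw [starSeq_of (by omega) (by omega) (by omega) (by omega),
      starSeq_of (by omega) (by omega) (by omega) (by omega)]
    exact hbelow i h1 h2
  lastR i h1 h2 h3 := by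
    rw [starSeq_of (by omega) (by omega) (by omega) (by omega),
      starSeq_of (by omega) (by omega) (by omega) (by omega)]
    exact hmono _ _ (hlast i h1 h2 h3) (htR _ h3 le_rfl)

lemma range_chain_starSeq (hN : q + 1 ≤ N)
    (ht : ∀ i, 1 ≤ i → i ≤ N + 2 → i ≠ q + 2 → i ≠ q + 3 → t i < N)
    (hsurj : ∀ k < N, ∃ i, 1 ≤ i ∧ i ≤ N + 2 ∧ i ≠ q + 2 ∧ i ≠ q + 3 ∧ t i = k) :
    range (chain (starSeq A B C s t q N) (N + 3)).vertices = {A, B, C} ∪ s '' Iio N := by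
  ext x
  constructor
  · rintro ⟨⟨i, hi⟩, rfl⟩
    change starSeq A B C s t q N i ∈ _
    unfold starSeq
    split_ifs with h1 h2 h3
    · simp
    · simp
    · simp
    · exact Or.inr ⟨t i, ht i (by omega) (by omega) h2 h3, rfl⟩
  · have key : ∀ i, i < N + 3 → starSeq A B C s t q N i = x →
        x ∈ range (chain (starSeq A B C s t q N) (N + 3)).vertices := fun i hi h => ⟨⟨i, hi⟩, h⟩
    rintro ((rfl | rfl | rfl) | ⟨k, hk, rfl⟩)
    · exact key (q + 2) (by omega) (by rw [starSeq, if_neg (by omega), if_pos rfl])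
    · exact key (q + 3) (by omega)
        (by rw [starSeq, if_neg (by omega), if_neg (by omega), if_pos rfl])
    · exact key 0 (by omega) (by simp [starSeq])
    · obtain ⟨i, h1, h2, h3, h4, rfl⟩ := hsurj k hk
      exact key i (by omega) (starSeq_of h1 h2 h3 h4)

end starSeq

/-! ### The configuration -/

/-- The first projective coordinate (from `pB`) of the configuration. -/
noncomputable def tau (m i : ℕ) : ℝ := if i < 2 * m then 4 ^ (i / 2) else 4 ^ i

/-- The second projective coordinate (from `pB`) of the configuration. -/
noncomputable def sig (m i : ℕ) : ℝ :=
  if i < 2 * m then (if i % 2 = 0 then 1 else -1) / ((i / 2 : ℕ) + 2) else 0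

/-- The points of the configuration, or of its mirror image if `e = -1`. -/
noncomputable def pt (e : ℝ) (m i : ℕ) : Plane :=
  !₂[tau m i / (1 + tau m i), e * sig m i / (1 + tau m i)]

lemma tau_pos (m i : ℕ) : 0 < tau m i := by unfold tau; split_ifs <;> positivity

/-- The excluded case is exactly that of the two members of one pair, which share their level. -/
lemma tau_growth {m i j : ℕ} (hij : i < j) (h : ¬ (i % 2 = 0 ∧ j = i + 1 ∧ j < 2 * m)) :
    4 * tau m i ≤ tau m j := by
  unfold tau
  split_ifs with h1 h2 h2
  · rw [← pow_succ']
    exact pow_le_pow_right₀ (by norm_num) (by omega)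
  · rw [← pow_succ']
    exact pow_le_pow_right₀ (by norm_num) (by omega)
  · omega
  · rw [← pow_succ']
    exact pow_le_pow_right₀ (by norm_num) (by omega)

lemma tau_succ {m i : ℕ} (hi : i % 2 = 0) (h : i + 1 < 2 * m) : tau m (i + 1) = tau m i := by
  unfold tau
  rw [if_pos h, if_pos (by omega), show (i + 1) / 2 = i / 2 by omega]

lemma sig_even {m i : ℕ} (hi : i % 2 = 0) (h : i < 2 * m) :
    sig m i = 1 / ((i / 2 : ℕ) + 2) := by
  rw [sig, if_pos h, if_pos hi]

lemma sig_odd {m i : ℕ} (hi : i % 2 = 1) (h : i < 2 * m) :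
    sig m i = -(1 / ((i / 2 : ℕ) + 2)) := by
  rw [sig, if_pos h, if_neg (by omega), neg_div]

lemma sig_bounds (m i : ℕ) : -(1 / 2) ≤ sig m i ∧ sig m i ≤ 1 / 2 := by
  have h1 : (1 : ℝ) / ((i / 2 : ℕ) + 2) ≤ 1 / 2 := by
    apply one_div_le_one_div_of_le <;> norm_num
  have h2 : (0 : ℝ) < 1 / ((i / 2 : ℕ) + 2) := by positivity
  by_cases h : i < 2 * m
  · rcases (by omega : i % 2 = 0 ∨ i % 2 = 1) with hi | hi
    · rw [sig_even hi h]; constructor <;> linarith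
    · rw [sig_odd hi h]; constructor <;> linarith
  · rw [sig, if_neg h]; norm_num

lemma sig_pos {m q : ℕ} (hq : q % 2 = 0) (h : q < 2 * m) : 0 < sig m q := by
  rw [sig_even hq h]; positivity

lemma sig_odd_neg {m i : ℕ} (hi : i % 2 = 1) (h : i < 2 * m) : sig m i < 0 := by
  rw [sig_odd hi h]
  exact neg_neg_of_pos (by positivity)

lemma sig_even_lt {m i j : ℕ} (hi : i % 2 = 0) (hj : j % 2 = 0) (hij : i < j) (h : j < 2 * m) :
    sig m j < sig m i := by
  rw [sig_even hi (by omega), sig_even hj h]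
  apply one_div_lt_one_div_of_lt (by positivity)
  have : i / 2 < j / 2 := by omega
  have : ((i / 2 : ℕ) : ℝ) < ((j / 2 : ℕ) : ℝ) := by exact_mod_cast this
  linarith

lemma sig_lt {m q i : ℕ} (hq : q % 2 = 0) (h : q < 2 * m) (hi : q < i) : sig m i < sig m q := by
  by_cases him : i < 2 * m
  · rcases (by omega : i % 2 = 0 ∨ i % 2 = 1) with h' | h'
    · exact sig_even_lt hq h' hi him
    · exact (sig_odd_neg h' him).trans (sig_pos hq h)
  · rw [show sig m i = 0 by rw [sig, if_neg him]]
    exact sig_pos hq h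

/-- The mirror image exchanges consecutive points of the configuration. -/
def mirror (m i : ℕ) : ℕ := if i < 2 * m then (if i % 2 = 0 then i + 1 else i - 1) else i

lemma mirror_lt {m N i : ℕ} (hN : 2 * m ≤ N) (hi : i < N) : mirror m i < N := by
  unfold mirror
  split_ifs <;> omega

/-- The members of a pair have opposite `sig` and equal `tau`, and the further points have `sig` =
0; so reflection only permutes indices. -/
lemma pt_mirror (e : ℝ) (m i : ℕ) : pt e m (mirror m i) = pt (-e) m i := by
  have h : tau m (mirror m i) = tau m i ∧ sig m (mirror m i) = -sig m i := by
    unfold mirror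
    split_ifs with h1 h2
    · exact ⟨tau_succ h2 (by omega), by
        rw [sig_odd (by omega) (by omega), sig_even h2 h1, show (i + 1) / 2 = i / 2 by omega]⟩
    · obtain ⟨k, rfl⟩ : ∃ k, i = k + 1 := ⟨i - 1, by omega⟩
      rw [Nat.add_sub_cancel]
      exact ⟨(tau_succ (by omega) h1).symm, by
        rw [sig_odd (by omega) h1, sig_even (by omega) (by omega),
          show (k + 1) / 2 = k / 2 by omega, neg_neg]⟩
    · exact ⟨rfl, by rw [sig, if_neg h1, neg_zero]⟩
  rw [pt, pt, h.1, h.2]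
  congr 3
  ring

/-! ### Angular orders of the configuration around the corners. -/

/-- The barycentric coordinate at `(0, e)`, where `e ^ 2 = 1`. -/
noncomputable def fE (e : ℝ) : Plane →ᵃ[ℝ] ℝ := aff (-1 / 2) (e / 2) (1 / 2)

/-- The vertex `(0, e)` of the reference triangle, where `e ^ 2 = 1`. -/
noncomputable def pE (e : ℝ) : Plane := !₂[0, e]

lemma isFrame {e : ℝ} (he : e * e = 1) : IsFrame (pE e) pB (pE (-e)) (fE e) fB (fE (-e)) where
  aA := by simp [fE, pE]; linarith
  aB := by simp [fE, pB]; norm_num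
  aC := by simp [fE, pE]; linarith
  bA := by simp [fB, pE]
  bB := by simp [fB, pB]
  bC := by simp [fB, pE]
  cA := by simp [fE, pE]; linarith
  cB := by simp [fE, pB]; norm_num
  cC := by simp [fE, pE]; linarith
  sum z := by simp [fE, fB]; ring

lemma fB_pt (e : ℝ) (m i : ℕ) : fB (pt e m i) = tau m i / (1 + tau m i) := by
  simp [fB, pt]

lemma fE_pt {e e' : ℝ} (m i : ℕ) :
    fE e' (pt e m i) = (1 + e' * e * sig m i) / (2 * (1 + tau m i)) := by
  have := tau_pos m i
  simp [fE, pt]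
  field_simp
  ring

lemma pos_pt {e : ℝ} (he : e * e = 1) (m i : ℕ) :
    0 < fE e (pt e m i) ∧ 0 < fB (pt e m i) ∧ 0 < fE (-e) (pt e m i) := by
  have h1 := tau_pos m i
  have h2 := sig_bounds m i
  rw [fE_pt, fE_pt, fB_pt, neg_mul, he]
  refine ⟨div_pos ?_ ?_, ?_, div_pos ?_ ?_⟩ <;> first | positivity | linarith

lemma turn_ba {e : ℝ} (he : e * e = 1) (m i j : ℕ) :
    turn fB (fE e) (pt e m i) (pt e m j) =
      ((1 + sig m i) * tau m j - tau m i * (1 + sig m j)) /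
        (2 * (1 + tau m i) * (1 + tau m j)) := by
  have h1 := tau_pos m i
  have h2 := tau_pos m j
  rw [turn_apply, fE_pt, fE_pt, fB_pt, fB_pt, he]
  field_simp

lemma turn_bc {e : ℝ} (he : e * e = 1) (m i j : ℕ) :
    turn fB (fE (-e)) (pt e m i) (pt e m j) =
      ((1 - sig m i) * tau m j - tau m i * (1 - sig m j)) /
        (2 * (1 + tau m i) * (1 + tau m j)) := by
  have h1 := tau_pos m i
  have h2 := tau_pos m j
  rw [turn_apply, fE_pt, fE_pt, fB_pt, fB_pt, neg_mul, he]
  field_simp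
  ring

lemma turn_ca {e : ℝ} (he : e * e = 1) (m i j : ℕ) :
    turn (fE (-e)) (fE e) (pt e m i) (pt e m j) =
      (sig m i - sig m j) / (2 * (1 + tau m i) * (1 + tau m j)) := by
  have h1 := tau_pos m i
  have h2 := tau_pos m j
  rw [turn_apply, fE_pt, fE_pt, fE_pt, fE_pt, neg_mul, he]
  field_simp
  ring

/-- The order around C. The factors 1 + `sig` lie in [1/2, 3/2], so their quotients are at most 3,
less than the growth factor 4 of `tau`. Within a pair, the larger `sig` of the even member decides.
-/
lemma turn_ba_pos {e : ℝ} (he : e * e = 1) {m i j : ℕ} (hij : i < j) :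
    0 < turn fB (fE e) (pt e m i) (pt e m j) := by
  have h1 := tau_pos m i
  have h2 := tau_pos m j
  have h3 := sig_bounds m i
  have h4 := sig_bounds m j
  rw [turn_ba he]
  refine div_pos ?_ (by positivity)
  by_cases h : i % 2 = 0 ∧ j = i + 1 ∧ j < 2 * m
  · obtain ⟨h5, rfl, h6⟩ := h
    have h7 := sig_lt h5 (by omega : i < 2 * m) (Nat.lt_succ_self i)
    rw [tau_succ h5 h6]
    nlinarith
  · have h5 := tau_growth hij h
    nlinarith

lemma turn_bc_pos {e : ℝ} (he : e * e = 1) {m i j : ℕ} (hij : i < j)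
    (h : ¬ (i % 2 = 0 ∧ j = i + 1 ∧ j < 2 * m)) :
    0 < turn fB (fE (-e)) (pt e m i) (pt e m j) := by
  have h1 := tau_pos m i
  have h2 := tau_pos m j
  have h3 := sig_bounds m i
  have h4 := sig_bounds m j
  rw [turn_bc he]
  refine div_pos ?_ (by positivity)
  have h5 := tau_growth hij h
  nlinarith

/-- Around A each pair appears in reverse; this swap lets q be placed on the right path although q +
1 is on the left one. -/
lemma turn_bc_succ {e : ℝ} (he : e * e = 1) {m q : ℕ} (hq : q % 2 = 0) (h : q + 1 < 2 * m) :
    0 < turn fB (fE (-e)) (pt e m (q + 1)) (pt e m q) := by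
  have h1 := tau_pos m q
  have h2 := sig_lt hq (by omega : q < 2 * m) (Nat.lt_succ_self q)
  rw [turn_bc he, tau_succ hq h]
  refine div_pos ?_ (by positivity)
  nlinarith

lemma turn_ca_pos {e : ℝ} (he : e * e = 1) {m i j : ℕ} (h : sig m j < sig m i) :
    0 < turn (fE (-e)) (fE e) (pt e m i) (pt e m j) := by
  have h1 := tau_pos m i
  have h2 := tau_pos m j
  rw [turn_ca he]
  exact div_pos (sub_pos.2 h) (by positivity)

/-! ### The chains that isolate a single guard. -/

/-- The order in which the chain for the point `q` visits the configuration. -/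
def order (q i : ℕ) : ℕ := if i ≤ q then i - 1 else if i = q + 4 then q else if i = q + 1 then q + 1
  else i - 3

lemma isStarChain_order {e : ℝ} (he : e * e = 1) {m N q : ℕ} (hN : 2 * m < N) (hq : q % 2 = 0)
    (hqm : q + 1 < 2 * m) :
    IsStarChain (pE e) pB (pE (-e)) (fE e) fB (fE (-e))
      (starSeq (pE e) pB (pE (-e)) (pt e m) (order q) q N) q (N + 2) := by
  have hq1 : order q (q + 1) = q + 1 := by unfold order; split_ifs <;> omega
  have hq4 : order q (q + 4) = q := by unfold order; split_ifs <;> omega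
  have hL : ∀ i, i ≤ q → order q i = i - 1 := fun i hi => by unfold order; split_ifs; rfl
  have hR : ∀ i, q + 5 ≤ i → order q i = i - 3 := fun i hi => by
    unfold order; split_ifs <;> omega
  refine isStarChain_starSeq (isFrame he) (by omega) (fun i _ => pos_pt he m i)
    (fun i j hij _ => turn_ba_pos he hij) ?_ ?_ ?_ ?_ ?_ ?_ ?_ ?_
  · intro i h1 h2; unfold order; split_ifs <;> omega
  · intro i h1 h2; unfold order; split_ifs <;> omega
  · intro i j h1 h2 h3; unfold order; split_ifs <;> omega
  · intro i j h1 h2 h3; unfold order; split_ifs <;> omega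
  · intro i h1 h2
    rw [hq1, hL i h2, turn_comm]
    exact neg_neg_of_pos (turn_bc_pos he (by omega) (by omega))
  · intro i h1 h2
    rw [hq1]
    rcases h1.eq_or_lt with rfl | h1
    · rw [hq4]
      exact turn_bc_succ he hq hqm
    · rw [hR i h1]
      exact turn_bc_pos he (by omega) (by omega)
  · intro i h1 h2
    rw [hq4, hR i h1]
    exact turn_ca_pos he (sig_lt hq (by omega) (by omega))
  -- The last index is N - 1 ≥ 2m, above all indices on the left path; this is where a point beyond
  -- the pairs is needed.
  · intro i h1 h2 h3; unfold order; split_ifs <;> omega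

lemma isStarChain_pred {e : ℝ} (he : e * e = 1) {m : ℕ} :
    IsStarChain (pE e) pB (pE (-e)) (fE e) fB (fE (-e))
      (starSeq (pE e) pB (pE (-e)) (pt e m) (fun i => i - 1) (2 * m) (2 * m + 1)) (2 * m)
      (2 * m + 1 + 2) := by
  refine isStarChain_starSeq (isFrame he) (by omega) (fun i _ => pos_pt he m i)
    (fun i j hij _ => turn_ba_pos he hij) ?_ ?_ ?_ ?_ ?_ ?_ ?_ ?_
  · intro i h1 h2; omega
  · intro i h1 h2; omega
  · intro i j h1 h2 h3; omega
  · intro i j h1 h2 h3; omega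
  · intro i h1 h2
    rw [turn_comm]
    exact neg_neg_of_pos (turn_bc_pos he (by omega) (by omega))
  · intro i h1 h2; omega
  · intro i h1 h2; omega
  · intro i h1 h2 h3; omega

lemma pA_eq : pA = pE 1 := rfl

lemma pC_eq : pC = pE (-1) := rfl

lemma mul_self_of_sign {e : ℝ} (he : e = 1 ∨ e = -1) : e * e = 1 := by
  rcases he with rfl | rfl <;> norm_num

lemma corners_eq {e : ℝ} (he : e = 1 ∨ e = -1) : ({pE e, pB, pE (-e)} : Set Plane) = corners := by
  rcases he with rfl | rfl
  · rfl
  · rw [neg_neg, corners, pA_eq, pC_eq]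
    ext x
    simp only [mem_insert_iff, mem_singleton_iff]
    tauto

lemma pt_pos (m i : ℕ) : 0 < fA (pt 1 m i) ∧ 0 < fB (pt 1 m i) ∧ 0 < fC (pt 1 m i) :=
  pos_pt (by norm_num) m i

lemma pt_notMem_corners (m i : ℕ) : pt 1 m i ∉ corners := by
  obtain ⟨h1, h2, -⟩ := pt_pos m i
  rintro (h | h | h)
  · rw [h, fB_pA] at h2; exact h2.false
  · rw [h, fA_pB] at h1; exact h1.false
  · rw [h, fA_pC] at h1; exact h1.false

lemma pt_injective {e : ℝ} (he : e * e = 1) (m : ℕ) : Function.Injective (pt e m) := by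
  have key : ∀ i j, i < j → pt e m i ≠ pt e m j := fun i j hij h => by
    have := turn_ba_pos he (m := m) hij
    rw [h, turn_self] at this
    exact this.false
  intro i j h
  rcases lt_trichotomy i j with hlt | heq | hlt
  · exact absurd h (key i j hlt)
  · exact heq
  · exact absurd h.symm (key j i hlt)

/-! ### The point set and its forced guards. -/

open Classical in
/-- The point set of the construction: a triangle with `N` interior points. -/
noncomputable def config (m N : ℕ) : Finset Plane :=
  {pA, pB, pC} ∪ (Finset.range N).image (pt 1 m)

lemma coe_config (m N : ℕ) : (config m N : Set Plane) = corners ∪ pt 1 m '' Iio N := by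
  simp only [config, Finset.coe_union, Finset.coe_insert, Finset.coe_singleton, Finset.coe_image,
    Finset.coe_range]
  rfl

lemma corners_subset_config (m N : ℕ) : corners ⊆ config m N := by
  rw [coe_config]; exact subset_union_left

lemma config_subset_triangle (m N : ℕ) : (config m N : Set Plane) ⊆ triangle := by
  rw [coe_config]
  refine union_subset corners_subset_triangle ?_
  rintro _ ⟨i, -, rfl⟩
  obtain ⟨h1, h2, h3⟩ := pt_pos m i
  exact ⟨h1.le, h2.le, h3.le⟩

lemma config_diff_corners (m N : ℕ) : (config m N : Set Plane) \ corners = pt 1 m '' Iio N := by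
  rw [coe_config, union_sdiff_left, sdiff_eq_left]
  rw [disjoint_left]
  rintro _ ⟨i, -, rfl⟩
  exact pt_notMem_corners m i

lemma interiorPoints_config (m N : ℕ) : interiorPoints (config m N) = pt 1 m '' Iio N := by
  rw [interiorPoints_eq (corners_subset_config m N) (config_subset_triangle m N),
    config_diff_corners]

lemma ncard_interiorPoints_config (m N : ℕ) : (interiorPoints (config m N)).ncard = N := by
  rw [interiorPoints_config, ncard_image_of_injective _ (pt_injective (by norm_num) m)]
  simp [← Finset.coe_Iio, ncard_coe_finset]

lemma card_config (m N : ℕ) : (config m N).card = N + 3 := by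
  classical
  have h1 : ({pA, pB, pC} : Finset Plane).card = 3 := by
    rw [Finset.card_eq_three]
    refine ⟨pA, pB, pC, ?_, ?_, ?_, rfl⟩ <;> intro h
    · have := fA_pA; rw [h, fA_pB] at this; exact zero_ne_one this
    · have := fA_pA; rw [h, fA_pC] at this; exact zero_ne_one this
    · have := fB_pB; rw [h, fB_pC] at this; exact zero_ne_one this
  have h2 : Disjoint ({pA, pB, pC} : Finset Plane) ((Finset.range N).image (pt 1 m)) := by
    rw [Finset.disjoint_left]
    intro x hx hx'
    obtain ⟨i, -, rfl⟩ := Finset.mem_image.1 hx'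
    exact pt_notMem_corners m i (by simpa [corners] using hx)
  have h3 : (config m N).card = ({pA, pB, pC} ∪ (Finset.range N).image (pt 1 m)).card := by
    unfold config; congr
  rw [h3, Finset.card_union_of_disjoint h2, h1,
    Finset.card_image_of_injective _ (pt_injective (by norm_num) m), Finset.card_range, add_comm]

lemma image_pt {e : ℝ} (he : e = 1 ∨ e = -1) {m N : ℕ} (hN : 2 * m ≤ N) :
    pt e m '' Iio N = pt 1 m '' Iio N := by
  rcases he with rfl | rfl
  · rfl
  apply subset_antisymm
  · rintro _ ⟨i, hi, rfl⟩
    exact ⟨mirror m i, mirror_lt hN hi, by rw [pt_mirror]⟩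
  · rintro _ ⟨i, hi, rfl⟩
    exact ⟨mirror m i, mirror_lt hN hi, by rw [pt_mirror, neg_neg]⟩

/-- A universal guard set contains every interior point `k` for which some polygon has a vertex
that is visible from no other interior point. -/
lemma pt_mem_of_unique_visible {e : ℝ} (he : e = 1 ∨ e = -1) {m N k l : ℕ} {f : ℕ → Plane}
    (hN : 2 * m ≤ N) (hs : IsSimple (chain f l))
    (hr : range (chain f l).vertices = {pE e, pB, pE (-e)} ∪ pt e m '' Iio N) {V : Plane}
    (hV : V ∈ range (chain f l).vertices)
    (hvis : ∀ i < N, i ≠ k → ¬ segment ℝ (pt e m i) V ⊆ region (chain f l))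
    {G : Finset Plane} (hG : IsInteriorUniversalGuardSet (config m N) G) : pt e m k ∈ G := by
  have hP : region (chain f l) ∈ simplePolygons (config m N) :=
    ⟨l, _, hs, by rw [hr, corners_eq he, image_pt he hN, coe_config], rfl⟩
  have hguard := hG.2 _ hP
  obtain ⟨j, hj⟩ := hV
  have hVr : V ∈ region (chain f l) := boundary_subset_region _ (hj ▸ vertex_mem_boundary _ j)
  rw [← hguard] at hVr
  obtain ⟨g, hg, hgV⟩ := mem_iUnion₂.1 hVr
  have hg' := hG.1 hg
  rw [interiorPoints_config, ← image_pt he hN] at hg'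
  obtain ⟨i, hi, rfl⟩ := hg'
  by_cases hik : i = k
  · exact hik ▸ hg
  · exact absurd hgV.2 (hvis i hi hik)

lemma pt_mem_of_even {e : ℝ} (he : e = 1 ∨ e = -1) {m N q : ℕ} (hN : 2 * m < N) (hq : q % 2 = 0)
    (hqm : q + 1 < 2 * m) {G : Finset Plane}
    (hG : IsInteriorUniversalGuardSet (config m N) G) : pt e m q ∈ G := by
  have he' := mul_self_of_sign he
  have h := isStarChain_order he' hN hq hqm
  have hq1 : order q (q + 1) = q + 1 := by unfold order; split_ifs <;> omega
  have hq4 : order q (q + 4) = q := by unfold order; split_ifs <;> omega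
  have f1 : starSeq (pE e) pB (pE (-e)) (pt e m) (order q) q N (q + 1) = pt e m (q + 1) := by
    rw [starSeq_of (by omega) (by omega) (by omega) (by omega), hq1]
  have f4 : starSeq (pE e) pB (pE (-e)) (pt e m) (order q) q N (q + 4) = pt e m q := by
    rw [starSeq_of (by omega) (by omega) (by omega) (by omega), hq4]
  have hr := range_chain_starSeq (A := pE e) (B := pB) (C := pE (-e)) (s := pt e m)
    (t := order q) (q := q) (N := N) (by omega)
    (fun i h1 h2 h3 h4 => by unfold order; split_ifs <;> omega)
    (fun k hk => by
      rcases (by omega : k < q ∨ k = q ∨ k = q + 1 ∨ q + 2 ≤ k) with h' | rfl | rfl | h'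
      · exact ⟨k + 1, by omega, by omega, by omega, by omega, by
          unfold order; split_ifs <;> omega⟩
      · exact ⟨k + 4, by omega, by omega, by omega, by omega, hq4⟩
      · exact ⟨q + 1, by omega, by omega, by omega, by omega, hq1⟩
      · exact ⟨k + 3, by omega, by omega, by omega, by omega, by
          unfold order; split_ifs <;> omega⟩)
  refine pt_mem_of_unique_visible he hN.le h.isSimple hr (V := pB) (by rw [hr]; simp) ?_ hG
  intro i hi hiq
  -- Every odd index, every later even index and every further point has smaller `sig` than q. Only
  -- even i < q remain.
  by_cases hlt : sig m i < sig m q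
  · refine h.not_visible_B_of_below (by omega) ?_
    rw [f4]
    exact turn_ca_pos he' hlt
  have hiq' : i < q := by
    rcases lt_trichotomy i q with h' | h' | h'
    · exact h'
    · exact absurd h' hiq
    · exact absurd (sig_lt hq (by omega) h') hlt
  have hi2 : i % 2 = 0 := by
    by_contra hodd
    exact hlt ((sig_odd_neg (by omega) (by omega)).trans (sig_pos hq (by omega)))
  refine h.not_visible_B_of_above (by omega) ?_ (pos_pt he' m i).2.2 ?_ ?_ ?_
  · rw [f4, starSeq_of (by omega) (by omega) (by omega) (by omega),
      show order q q = q - 1 by unfold order; split_ifs <;> omega]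
    -- The vertex before q + 1 is q - 1, an odd point; so the edge between them stays below the line
    -- Bq and does not close the pocket.
    exact (turn_ca_pos he'
      ((sig_odd_neg (by omega) (by omega)).trans (sig_pos hq (by omega)))).le
  · rw [f4, turn_comm]
    exact neg_neg_of_pos (turn_ca_pos he' (sig_even_lt hi2 hq hiq' (by omega)))
  · rw [f1, turn_comm]
    exact neg_neg_of_pos (turn_bc_pos he' (by omega) (by omega))
  · rw [f4, f1]
    exact (turn_ca_pos he' (sig_lt hq (by omega) (by omega))).le

/-- All points are visited in order before A, so the right path is empty and all but the last point
lie beyond the edge from the last point to A. -/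
lemma pt_last_mem {m : ℕ} {G : Finset Plane}
    (hG : IsInteriorUniversalGuardSet (config m (2 * m + 1)) G) : pt 1 m (2 * m) ∈ G := by
  have he : (1 : ℝ) = 1 ∨ (1 : ℝ) = -1 := Or.inl rfl
  have he' := mul_self_of_sign he
  have h := isStarChain_pred he' (m := m)
  have hr := range_chain_starSeq (A := pE 1) (B := pB) (C := pE (-1)) (s := pt 1 m)
    (t := fun i => i - 1) (q := 2 * m) (N := 2 * m + 1) (by omega)
    (fun i h1 h2 h3 h4 => by omega)
    (fun k hk => ⟨k + 1, by omega, by omega, by omega, by omega, by omega⟩)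
  refine pt_mem_of_unique_visible he (by omega) h.isSimple hr (V := pE 1) (by rw [hr]; simp) ?_ hG
  intro i hi hik
  apply h.not_visible_A
  rw [starSeq_of (by omega) (by omega) (by omega) (by omega), turn_comm]
  exact neg_neg_of_pos (turn_bc_pos he' (by omega) (by omega))

/-- Odd points are the mirror images of even ones, so they are obtained with e = -1. -/
lemma pt_mem_of_lt {m N i : ℕ} (hN : 2 * m < N) (hi : i < 2 * m) {G : Finset Plane}
    (hG : IsInteriorUniversalGuardSet (config m N) G) : pt 1 m i ∈ G := by
  rcases (by omega : i % 2 = 0 ∨ i % 2 = 1) with h | h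
  · exact pt_mem_of_even (Or.inl rfl) hN h (by omega) hG
  · have h1 := pt_mem_of_even (e := -1) (q := i - 1) (Or.inr rfl) hN (by omega) (by omega) hG
    rw [← pt_mirror] at h1
    rwa [show mirror m (i - 1) = i by unfold mirror; split_ifs <;> omega] at h1

lemma isInteriorUniversalGuardSet_config {m N : ℕ} (hN : 0 < N) {G : Finset Plane}
    (hG : (G : Set Plane) = interiorPoints (config m N)) :
    IsInteriorUniversalGuardSet (config m N) G := by
  refine isInteriorUniversalGuardSet_of_eq (corners_subset_config m N) (config_subset_triangle m N)
    ?_ ?_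
  · rw [config_diff_corners]
    exact ⟨_, 0, hN, rfl⟩
  · rw [hG, config_diff_corners, interiorPoints_config]

lemma isInteriorUniversalGuardSet_config_iff (m : ℕ) (G : Finset Plane) :
    IsInteriorUniversalGuardSet (config m (2 * m + 1)) G ↔
      (G : Set Plane) = interiorPoints (config m (2 * m + 1)) := by
  refine ⟨fun hG => hG.1.antisymm ?_, isInteriorUniversalGuardSet_config (by omega)⟩
  rw [interiorPoints_config]
  rintro _ ⟨i, hi, rfl⟩
  rcases (Nat.lt_succ_iff.1 hi).lt_or_eq with h | rfl
  · exact pt_mem_of_lt (by omega) h hG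
  · exact pt_last_mem hG

lemma le_card_of_isInteriorUniversalGuardSet {m N : ℕ} (hN : 2 * m < N) {G : Finset Plane}
    (hG : IsInteriorUniversalGuardSet (config m N) G) : 2 * m ≤ G.card := by
  classical
  rw [← Finset.card_range (2 * m),
    ← Finset.card_image_of_injective (Finset.range (2 * m)) (pt_injective (e := 1) (by norm_num) m)]
  refine Finset.card_le_card fun x hx => ?_
  obtain ⟨i, hi, rfl⟩ := Finset.mem_image.1 hx
  exact pt_mem_of_lt hN (Finset.mem_range.1 hi) hG

/-! ### Collinear points -/

/-- Both neighbours of the leftmost vertex lie to its right, so the nearer one lies on the edge to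
the other. -/
lemma not_isSimple_of_line {m : ℕ} {v : Polygon Plane m} (h0 : ∀ i, v i 1 = 0) : ¬ IsSimple v := by
  intro hv
  have hm := hv.1
  have : Nonempty (Fin m) := ⟨⟨0, by omega⟩⟩
  obtain ⟨i, hi⟩ := Finite.exists_min (fun i => v i 0)
  obtain ⟨k, rfl⟩ := (finRotate m).surjective i
  set i := finRotate m k with hik
  set j := finRotate m i with hij
  have hX : ∀ l, l ≠ i → v i 0 < v l 0 := by
    intro l hl
    refine (hi l).lt_of_ne fun h => hl (hv.2.1 ?_)
    ext d
    fin_cases d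
    · exact h.symm
    · exact (h0 l).trans (h0 i).symm
  have hki : k ≠ i := fun h => hv.ne_next k (congrArg v h)
  have hji : j ≠ i := fun h => hv.ne_next i (congrArg v h.symm)
  have hkj : k ≠ j := by
    intro h
    obtain ⟨M, rfl⟩ : ∃ M, m = M + 1 := ⟨m - 1, by omega⟩
    rw [hij, hik, finRotate_apply, finRotate_apply] at h
    have h1 := congrArg Fin.val h
    rw [Fin.val_add_one] at h1
    split_ifs at h1 with h2
    · have h3 := congrArg Fin.val h2
      rw [Fin.val_add_one, Fin.val_last] at h3
      split_ifs at h3 <;> omega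
    · rw [Fin.val_add_one] at h1
      split_ifs at h1 with h3
      · rw [h3, Fin.val_last] at h1
        omega
      · omega
  have hseg : ∀ x y : Plane, x 1 = 0 → y 1 = 0 → v i 0 < x 0 → x 0 ≤ y 0 →
      x ∈ segment ℝ (v i) y := by
    intro x y hx hy h1 h2
    have hpos : 0 < y 0 - v i 0 := by linarith
    rw [segment_eq_image']
    refine ⟨(x 0 - v i 0) / (y 0 - v i 0), ⟨div_nonneg (by linarith) hpos.le,
      (div_le_one hpos).2 (by linarith)⟩, ?_⟩
    ext d
    fin_cases d
    · simp
      field_simp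
      ring
    · simp [h0, hx, hy]
  have hne := hv.2.1
  rcases le_total (v k 0) (v j 0) with h | h
  · rcases hv.eq_or_eq hki.symm (hseg _ _ (h0 k) (h0 j) (hX k hki) h)
      (left_mem_segment _ _ _) with h' | h'
    · exact hki (hne h')
    · exact hkj (hne h')
  · have h1 := hseg _ _ (h0 j) (h0 k) (hX j hji) h
    rw [segment_symm] at h1
    rcases hv.eq_or_eq hki h1 (right_mem_segment ℝ (v i) (v j)) with h' | h'
    · exact hkj (hne h').symm
    · exact hji (hne h')

/-- Collinear points have no simple polygon, so the empty set guards vacuously with count 0. This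
makes the supremum a maximum for every n. -/
lemma minInteriorGuardCounts_nonempty (n : ℕ) : (minInteriorGuardCounts n).Nonempty := by
  classical
  set p : ℕ → Plane := fun i => !₂[(i : ℝ), 0] with hp
  have hinj : Function.Injective p := by
    intro i j h
    have := congrArg (fun z : Plane => z 0) h
    simpa [hp] using this
  refine ⟨0, (Finset.range n).image p, ?_, ⟨∅, ⟨by simp, ?_⟩, rfl⟩, fun k _ => Nat.zero_le k⟩
  · rw [Finset.card_image_of_injective _ hinj, Finset.card_range]
  · rintro P ⟨m, v, hv, hr, -⟩
    refine absurd hv (not_isSimple_of_line fun i => ?_)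
    have : v i ∈ (((Finset.range n).image p : Finset Plane) : Set Plane) := hr ▸ ⟨i, rfl⟩
    obtain ⟨j, -, hj⟩ := Finset.mem_image.1 this
    rw [← hj]
    simp [hp]

/-! ### Bounds on the interior universal guard number -/

lemma le_of_mem_minInteriorGuardCounts {n k : ℕ} (h : k ∈ minInteriorGuardCounts n) : k ≤ n := by
  obtain ⟨S, rfl, ⟨G, hG, rfl⟩, -⟩ := h
  exact Finset.card_le_card fun x hx => (hG.1 hx).1

/-- The hull of a nonempty finite set has an extreme point; it belongs to the set and cannot be a
guard. -/
lemma lt_of_mem_minInteriorGuardCounts {n k : ℕ} (hn : 0 < n) (h : k ∈ minInteriorGuardCounts n) :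
    k < n := by
  obtain ⟨S, rfl, ⟨G, hG, rfl⟩, -⟩ := h
  obtain ⟨x, hx⟩ : (extremePoints ℝ (convexHull ℝ (S : Set Plane))).Nonempty :=
    (S.finite_toSet.isCompact_convexHull ℝ).extremePoints_nonempty
      ((Finset.card_pos.1 hn).to_set.convexHull)
  refine Finset.card_lt_card ((Finset.ssubset_iff_of_subset fun x hx => (hG.1 hx).1).2
    ⟨x, extremePoints_convexHull_subset (𝕜 := ℝ) hx, fun hxG => (hG.1 hxG).2 hx⟩)

lemma isGreatest_interiorUniversalGuardNumber (n : ℕ) :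
    IsGreatest (minInteriorGuardCounts n) (interiorUniversalGuardNumber n) := by
  have hb : BddAbove (minInteriorGuardCounts n) := ⟨n, fun _ => le_of_mem_minInteriorGuardCounts⟩
  exact ⟨Nat.sSup_mem (minInteriorGuardCounts_nonempty n) hb, fun _ hk => le_csSup hb hk⟩

lemma le_interiorUniversalGuardNumber {n : ℕ} (hn : 6 ≤ n) :
    n ≤ interiorUniversalGuardNumber n + 5 := by
  classical
  -- As many pairs as fit into n - 3 interior points while leaving at least one further point; then
  -- 2m ≥ n - 5.
  set m := (n - 4) / 2 with hm
  have hN : 2 * m < n - 3 := by omega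
  have hne : {k : ℕ | ∃ G : Finset Plane,
      IsInteriorUniversalGuardSet (config m (n - 3)) G ∧ G.card = k}.Nonempty :=
    ⟨_, (Finset.range (n - 3)).image (pt 1 m), isInteriorUniversalGuardSet_config (by omega) (by
      rw [interiorPoints_config, Finset.coe_image, Finset.coe_range]), rfl⟩
  have hmem := Nat.sInf_mem hne
  have hleast : IsMinInteriorGuardCount (config m (n - 3)) _ := ⟨hmem, fun k hk => Nat.sInf_le hk⟩
  have hle := (isGreatest_interiorUniversalGuardNumber n).2
    ⟨config m (n - 3), by rw [card_config]; omega, hleast⟩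
  obtain ⟨G, hG, hGc⟩ := hmem
  have := le_card_of_isInteriorUniversalGuardSet hN hG
  omega

lemma interiorUniversalGuardNumber_lt {n : ℕ} (hn : 0 < n) : interiorUniversalGuardNumber n < n :=
  lt_of_mem_minInteriorGuardCounts hn (isGreatest_interiorUniversalGuardNumber n).1

end UniversalGuard

theorem mainTheorem6 :
    -- the maximum defining the interior universal guard number is attained
    (∀ n : ℕ, IsGreatest (UniversalGuard.minInteriorGuardCounts n)
      (UniversalGuard.interiorUniversalGuardNumber n)) ∧
    -- it equals `n - Θ(1)`
    ((fun n : ℕ => (n : ℝ) - (UniversalGuard.interiorUniversalGuardNumber n : ℝ))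
      =Θ[Filter.atTop] (fun _ : ℕ => (1 : ℝ))) ∧
    -- arbitrarily large examples with a triangular hull that need all interior points
    (∀ N : ℕ, ∃ n : ℕ, N ≤ n ∧ ∃ S : Finset UniversalGuard.Plane, S.card = n ∧
      (∃ a b c : UniversalGuard.Plane, AffineIndependent ℝ ![a, b, c] ∧
        convexHull ℝ (S : Set UniversalGuard.Plane) = convexHull ℝ {a, b, c}) ∧
      (UniversalGuard.interiorPoints S).ncard + 3 = n ∧
      ∀ G : Finset UniversalGuard.Plane, UniversalGuard.IsInteriorUniversalGuardSet S G ↔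
        (G : Set UniversalGuard.Plane) = UniversalGuard.interiorPoints S) := by
  refine ⟨UniversalGuard.isGreatest_interiorUniversalGuardNumber, ⟨?_, ?_⟩, fun N => ?_⟩
  · refine Asymptotics.IsBigO.of_bound 5 ?_
    filter_upwards [Filter.eventually_ge_atTop 6] with n hn
    have h1 : (n : ℝ) ≤ UniversalGuard.interiorUniversalGuardNumber n + 5 := by
      exact_mod_cast UniversalGuard.le_interiorUniversalGuardNumber hn
    have h2 : (UniversalGuard.interiorUniversalGuardNumber n : ℝ) < n := by
      exact_mod_cast UniversalGuard.interiorUniversalGuardNumber_lt (by omega)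
    rw [Real.norm_of_nonneg (by linarith), norm_one]
    linarith
  · refine Asymptotics.IsBigO.of_bound 1 ?_
    filter_upwards [Filter.eventually_ge_atTop 1] with n hn
    have h2 : (UniversalGuard.interiorUniversalGuardNumber n : ℝ) + 1 ≤ n := by
      exact_mod_cast UniversalGuard.interiorUniversalGuardNumber_lt hn
    rw [norm_one, Real.norm_of_nonneg (by linarith)]
    linarith
  · refine ⟨2 * N + 1 + 3, by omega, UniversalGuard.config N (2 * N + 1),
      UniversalGuard.card_config _ _, ⟨_, _, _, UniversalGuard.affineIndependent_corners, ?_⟩, ?_,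
      UniversalGuard.isInteriorUniversalGuardSet_config_iff N⟩
    · rw [UniversalGuard.convexHull_eq_triangle (UniversalGuard.corners_subset_config _ _)
        (UniversalGuard.config_subset_triangle _ _)]
      exact UniversalGuard.convexHull_corners.symm
    · rw [UniversalGuard.ncard_interiorPoints_config]
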